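/- Let $d\ge 1$ and $q\ge 0$ be integers. For $r\in\{0,\dots,d\}$ and real $d\times d$ matrices $A,B$ let $$\gamma_r(A,B)=\sum_{I\subset\{1,\dots,d\},\ \#I=r}\det\big(G^I_{A,B}\big),$$ where $G^I_{A,B}$ is the $d\times d$ matrix whose $i$th column is the $i$th column of $A$ if $i\in I$ and the $i$th column of $B$ if $i\notin I$ (so $\gamma_r(A,B)$ is the coefficient of $h^{d-r}$ in $\det(A+hB)$). For $v_j=\binom{x_j}{y_j}\in\mathbb R^{2d}$ with $x_j,y_j\in\mathbb R^d$, $j=1,\dots,d$, put $$F_r(v_1,\dots,v_d)=\gamma_r\big((x_1,\dots,x_d),(y_1,\dots,y_d)\big)^2 ,$$ where $(x_1,\dots,x_d)$ denotes the matrix with columns $x_1,\dots,x_d$. Let $W$ and $W'$ be independent standard Brownian motions (started at $0$) of respective dimensions $q$ and $d$ on a filtered probability space, with expectation $\mathbb E$. Let $u=(\alpha,\beta,\gamma,a)$ with $\alpha\in\mathbb R^{d\times q}$, $\beta\in\mathbb R^{d\times d}$, $\gamma\in\mathbb R^{d\times q\times q}$ and $a\in\mathbb R^d$. For $\kappa\in\{1,2\}$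 and $i\ge 1$ let $\Psi(u,\kappa)_i$ be the $\mathbb R^{2d}$-valued random variable with components, for $l=1,\dots,d$, $$\Psi(u,\kappa)^l_i=\frac1{\sqrt\kappa}\sum_{m=1}^q\alpha^{lm}\big(W^m_{\kappa i}-W^m_{\kappa(i-1)}\big),$$ $$\Psi(u,\kappa)^{d+l}_i=a^l+\frac1{\sqrt\kappa}\sum_{m=1}^d\beta^{lm}\big(W'^m_{\kappa i}-W'^m_{\kappa(i-1)}\big)+\frac1\kappa\sum_{m,k=1}^q\gamma^{lmk}\int_{\kappa(i-1)}^{\kappa i}W^k_s\,dW^m_s,$$ the last integrals being It\^o integrals, and let $F_r(u,\kappa)=F_r\big(\Psi(u,\kappa)_1,\dots,\Psi(u,\kappa)_d\big)$. Assume that $\beta$ is invertible, and let $r\in\{0,\dots,d\}$. Then $F_r(u,1)$ and $F_r(u,2)$ are square-integrable, with $\mathbb E[F_r(u,1)]=\mathbb E[F_r(u,2)]$ and $\mathbb E[F_r(u,1)^2]=\mathbb E[F_r(u,2)^2]$, so that one may set $$\Gamma_r(u)=\mathbb E[F_r(u,1)]=\mathbb E[F_r(u,2)],$$ $$\Gamma'_r(u)=\mathbb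 E[F_r(u,1)^2]-\Gamma_r(u)^2=\mathbb E[F_r(u,2)^2]-\Gamma_r(u)^2,$$ $$\Gamma''_r(u)=\mathbb E[F_r(u,1)F_r(u,2)]-\Gamma_r(u)^2 ,$$ and the following hold: - if $\operatorname{rank}(\alpha)=r$, then $\Gamma_r(u)>0$ and $\Gamma'_r(u)>\Gamma''_r(u)$; - if $\operatorname{rank}(\alpha)<r$, then $\Gamma_r(u)=\Gamma'_r(u)=\Gamma''_r(u)=0$. -/

import Mathlib

open MeasureTheory ProbabilityTheory Filter
open scoped NNReal ENNReal Topology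

noncomputable section

namespace RankTest

/-- The coefficient `γ_r(A, B)` of `h ^ (d - r)` in the expansion of `det (A + h B)`: the sum, over
all sets `I` of `r` column indices, of the determinant of the matrix whose columns with index in
`I` are those of `A` and whose other columns are those of `B`. -/
def gammaCoef {d : ℕ} (r : ℕ) (A B : Matrix (Fin d) (Fin d) ℝ) : ℝ :=
  ∑ I ∈ (Finset.univ : Finset (Fin d)).powersetCard r,
    (Matrix.of fun i j => if j ∈ I then A i j else B i j).det

/-- The function `F_r` on `(ℝ^{2d})^d`: if `v_j = (x_j, y_j)`, then
`F_r(v_1, …, v_d) = γ_r(mat(x_1, …, x_d), mat(y_1, …, y_d))²`. The first `d` coordinates of a vector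
of `ℝ^{2d}` are indexed by `Sum.inl`, the last `d` ones by `Sum.inr`. -/
def detFun {d : ℕ} (r : ℕ) (v : Fin d → (Fin d ⊕ Fin d) → ℝ) : ℝ :=
  gammaCoef r (Matrix.of fun l j => v j (Sum.inl l)) (Matrix.of fun l j => v j (Sum.inr l)) ^ 2

/-- The parameters `u = (α, β, γ, a)`. -/
structure Param (d q : ℕ) where
  α : Matrix (Fin d) (Fin q) ℝ
  β : Matrix (Fin d) (Fin d) ℝ
  γ : Fin d → Fin q → Fin q → ℝ
  a : Fin d → ℝ

variable {Ω : Type*} [mΩ : MeasurableSpace Ω]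

/-- `B` is a (standard, started at `0`) Brownian motion with components indexed by `ι`, with respect
to the filtration `𝓕`: it is adapted, its components are independent real Brownian motions, and
the increments after time `s` are independent of `𝓕 s`. -/
structure IsBrownianMotion {ι : Type*} (𝓕 : Filtration ℝ≥0 mΩ) (P : Measure Ω)
    (B : ι → ℝ≥0 → Ω → ℝ) : Prop where
  adapted : ∀ m, Adapted 𝓕 (B m)
  isBrownianReal : ∀ m, IsBrownianReal (B m) P
  iIndepFun_components : iIndepFun (fun m ω (t : ℝ≥0) => B m t ω) P
  indep_increments : ∀ s : ℝ≥0,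
    Indep (MeasurableSpace.comap (fun ω (p : ι × ℝ≥0) => B p.1 (s + p.2) ω - B p.1 s ω) inferInstance)
      (𝓕 s) P

/-- A simple process `∑_{j < n} ξ_j 1_{(t_j, t_{j+1}]}` on `[a, b]`, where `a = t_0 ≤ … ≤ t_n = b`
and `ξ_j` is square-integrable and `𝓕 t_j`-measurable. -/
structure SimpleProcess (𝓕 : Filtration ℝ≥0 mΩ) (P : Measure Ω) (a b : ℝ≥0) where
  n : ℕ
  time : ℕ → ℝ≥0
  monotone_time : Monotone time
  time_zero : time 0 = a
  time_last : time n = b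
  coef : ℕ → Ω → ℝ
  measurable_coef : ∀ j, Measurable[𝓕 (time j)] (coef j)
  memLp_coef : ∀ j, MemLp (coef j) 2 P

namespace SimpleProcess

variable {𝓕 : Filtration ℝ≥0 mΩ} {P : Measure Ω} {a b : ℝ≥0}

/-- The value of a simple process at time `t`. -/
def eval (S : SimpleProcess 𝓕 P a b) (t : ℝ≥0) (ω : Ω) : ℝ :=
  ∑ j ∈ Finset.range S.n, (Set.Ioc (S.time j) (S.time (j + 1))).indicator (fun _ => S.coef j ω) t

/-- The stochastic integral over `[a, b]` of a simple process against `B`. -/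
def integral (S : SimpleProcess 𝓕 P a b) (B : ℝ≥0 → Ω → ℝ) (ω : Ω) : ℝ :=
  ∑ j ∈ Finset.range S.n, S.coef j ω * (B (S.time (j + 1)) ω - B (S.time j) ω)

end SimpleProcess

/-- `J` is the Itô integral `∫_a^b H dB`, where `B` is a Brownian motion for `𝓕` and `H` is an adapted
process with `E ∫_a^b H_t² dt < ∞`: there are simple processes `S_n` with
`E ∫_a^b (S_n(t) - H_t)² dt → 0` whose stochastic integrals against `B` converge to `J` in `L²(P)`.
By Itô's isometry such a `J` is unique up to almost sure equality. -/
def IsItoIntegral (𝓕 : Filtration ℝ≥0 mΩ) (P : Measure Ω) (H B : ℝ≥0 → Ω → ℝ) (a b : ℝ≥0)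
    (J : Ω → ℝ) : Prop :=
  MemLp J 2 P ∧ ∃ S : ℕ → SimpleProcess 𝓕 P a b,
    Tendsto (fun n => ∫⁻ ω, (∫⁻ t in Set.Icc (a : ℝ) b,
      ENNReal.ofReal (((S n).eval t.toNNReal ω - H t.toNNReal ω) ^ 2)) ∂P) atTop (𝓝 0) ∧
    Tendsto (fun n => eLpNorm (fun ω => (S n).integral B ω - J ω) 2 P) atTop (𝓝 0)

open Classical in
/-- The Itô integral `∫_a^b H dB` (a version of it; `0` if it does not exist). -/
def itoIntegral (𝓕 : Filtration ℝ≥0 mΩ) (P : Measure Ω) (H B : ℝ≥0 → Ω → ℝ) (a b : ℝ≥0) : Ω → ℝ :=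
  if h : ∃ J, IsItoIntegral 𝓕 P H B a b J then h.choose else 0

section Moments

variable {d q : ℕ} (𝓕 : Filtration ℝ≥0 mΩ) (P : Measure Ω) (W : Fin q → ℝ≥0 → Ω → ℝ)
  (W' : Fin d → ℝ≥0 → Ω → ℝ) (u : Param d q)

/-- The variable `Ψ(u, κ)_{i+1}` with values in `ℝ^{2d}`, for `i = 0, 1, …`; it is built on the time
interval `[κ i, κ (i + 1)]`. -/
def Psi (κ i : ℕ) (ω : Ω) : (Fin d ⊕ Fin d) → ℝ
  | Sum.inl l =>
      1 / √(κ : ℝ) * ∑ m, u.α l m * (W m (κ * (i + 1)) ω - W m (κ * i) ω)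
  | Sum.inr l =>
      u.a l + 1 / √(κ : ℝ) * ∑ m, u.β l m * (W' m (κ * (i + 1)) ω - W' m (κ * i) ω)
        + 1 / (κ : ℝ) * ∑ m, ∑ k,
            u.γ l m k * itoIntegral 𝓕 P (W k) (W m) (κ * i) (κ * (i + 1)) ω

/-- `F_r(u, κ) = F_r(Ψ(u, κ)_1, …, Ψ(u, κ)_d)`. -/
def FVar (r κ : ℕ) (ω : Ω) : ℝ :=
  detFun r fun j : Fin d => Psi 𝓕 P W W' u κ (j : ℕ) ω

/-- `Γ_r(u) = E[F_r(u, 1)]`. -/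
def Gam (r : ℕ) : ℝ := ∫ ω, FVar 𝓕 P W W' u r 1 ω ∂P

/-- `Γ'_r(u) = E[F_r(u, 1)²] - Γ_r(u)²`. -/
def Gam' (r : ℕ) : ℝ := ∫ ω, FVar 𝓕 P W W' u r 1 ω ^ 2 ∂P - Gam 𝓕 P W W' u r ^ 2

/-- `Γ''_r(u) = E[F_r(u, 1) F_r(u, 2)] - Γ_r(u)²`. -/
def Gam'' (r : ℕ) : ℝ :=
  ∫ ω, FVar 𝓕 P W W' u r 1 ω * FVar 𝓕 P W W' u r 2 ω ∂P - Gam 𝓕 P W W' u r ^ 2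

end Moments

end RankTest

end

/-!
Every Itô integral `∫ W^k dW^m` is an `L²` limit of left-endpoint Riemann sums: by Itô's isometry the
integrals of any two sequences of simple processes that approximate `W^k` have the same limit
(`IsItoIntegral.tendsto_eLpNorm`). Riemann sums are functions of the path, and the Riemann sums on
`[κ i, κ (i + 1)]` are `κ` times those on `[i, i + 1]` along the rescaled path
`t ↦ κ^{-1/2} W (κ t)`. Rescaling preserves the law of `W`, so the limits are given by one
functional of the rescaled path which does not depend on `κ`
(`IsBrownianMotion.exists_itoIntegral_functional`). Hence `F_r(u, 1)` and `F_r(u, 2)` are almost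
surely one and the same functional of two pairs of paths with the same law, and their moments agree
(`integral_FVar_pow_eq`).

The variables `F_r(u, κ)` are polynomials in Gaussian variables and Itô integrals, so it is enough
that the latter have moments of all orders. The exponential moments of a Riemann sum `R` with
quadratic variation `V` are controlled by
`exp (c R) ≤ exp (2 c R - 2 c² V) + exp (2 c² V)`, where the first term has expectation one and the
second is bounded, for small `c`, by convexity and the exponential moments of squared Gaussian
variables. The bound is uniform in the mesh and passes to the limit (`IsItoIntegral.memLp`).

If `rank α < r`, all determinants in `γ_r` vanish. If `rank α = r`, everything follows from
`F_r(u, 1)` and `F_r(u, 2)` not being almost surely equal: these variables are nonnegative with the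
same mean, so a vanishing mean would make both of them zero, and `2 (Γ' - Γ'')` is the second moment
of their difference. To distinguish them, note that `F_r(u, 1)` depends on the paths up to time `d`
and `F_r(u, 2)` on the paths up to time `2 d`. By Fubini's theorem and since the increments of a
Brownian motion charge all open sets, an almost sure equality could be tested at arbitrary increments
of `W'` for almost every path of `W`. When `r < d` these are chosen so that `γ_r` reduces to a single
nonzero determinant (`gammaCoef_eq_mul_det_mixCols`); doubling its last column, which involves the
increment over `[2 d - 1, 2 d]` only, changes `F_r(u, 2)` but not `F_r(u, 1)`. When `r = d` the same
is done with the increments of `W`.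
-/

namespace RankTest

/-! ### Scalar Brownian motion with respect to a filtration -/

section

variable {Ω : Type*} [mΩ : MeasurableSpace Ω]

/-- `B` is a real Brownian motion for the filtration `𝓕`: the one-dimensional form of
`IsBrownianMotion`, in which only single increments are required to be independent of the past. -/
structure IsScalarBrownianMotion (𝓕 : Filtration ℝ≥0 mΩ) (P : Measure Ω) (B : ℝ≥0 → Ω → ℝ) :
    Prop where
  adapted : Adapted 𝓕 B
  isBrownianReal : IsBrownianReal B P
  indep : ∀ {s t : ℝ≥0}, s ≤ t →
    Indep (MeasurableSpace.comap (fun ω => B t ω - B s ω) inferInstance) (𝓕 s) P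

lemma IsBrownianMotion.component {ι : Type*} {𝓕 : Filtration ℝ≥0 mΩ} {P : Measure Ω}
    {B : ι → ℝ≥0 → Ω → ℝ} (h : IsBrownianMotion 𝓕 P B) (m : ι) :
    IsScalarBrownianMotion 𝓕 P (B m) where
  adapted := h.adapted m
  isBrownianReal := h.isBrownianReal m
  indep {s t} hst := by
    refine indep_of_indep_of_le_left (h.indep_increments s) ?_
    have : (fun ω => B m t ω - B m s ω) =
        (fun x : ι × ℝ≥0 → ℝ => x (m, t - s)) ∘
          fun ω (p : ι × ℝ≥0) => B p.1 (s + p.2) ω - B p.1 s ω := by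
      ext ω
      simp [add_tsub_cancel_of_le hst]
    rw [this, ← MeasurableSpace.comap_comp]
    exact MeasurableSpace.comap_mono (measurable_pi_apply (m, t - s)).comap_le

namespace IsScalarBrownianMotion

variable {𝓕 : Filtration ℝ≥0 mΩ} {P : Measure Ω} {B : ℝ≥0 → Ω → ℝ} {s t s' t' : ℝ≥0}
  {ξ ξ' : Ω → ℝ}

lemma measurable (h : IsScalarBrownianMotion 𝓕 P B) (t : ℝ≥0) : Measurable (B t) :=
  (h.adapted t).mono (𝓕.le t) le_rfl

lemma indepFun (h : IsScalarBrownianMotion 𝓕 P B) (hst : s ≤ t) {E : Type*} [MeasurableSpace E]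
    {Z : Ω → E} (hZ : Measurable[𝓕 s] Z) : IndepFun Z (fun ω => B t ω - B s ω) P :=
  (indep_of_indep_of_le_right (h.indep hst) hZ.comap_le).symm

lemma hasLaw_increment (h : IsScalarBrownianMotion 𝓕 P B) (hst : s ≤ t) :
    HasLaw (fun ω => B t ω - B s ω) (gaussianReal 0 (t - s)) P := by
  have := h.isBrownianReal.hasLaw_sub t s
  have e : nndist t.1 s.1 = t - s := by
    have : (s : ℝ) ≤ t := hst
    ext
    rw [coe_nndist, Real.dist_eq, NNReal.coe_sub hst, abs_of_nonneg]
    · rfl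
    · exact sub_nonneg.2 this
  rw [e] at this
  exact this

lemma memLp_eval (h : IsScalarBrownianMotion 𝓕 P B) (t p : ℝ≥0) : MemLp (B t) p P := by
  have := memLp_id_gaussianReal (μ := 0) (v := t) p
  rw [← (h.isBrownianReal.hasLaw_eval t).map_eq] at this
  exact (memLp_map_measure_iff this.1 (h.measurable t).aemeasurable).1 this

lemma memLp_increment (h : IsScalarBrownianMotion 𝓕 P B) (s t p : ℝ≥0) :
    MemLp (fun ω => B t ω - B s ω) p P := (h.memLp_eval t p).sub (h.memLp_eval s p)

lemma integral_mul_increment (h : IsScalarBrownianMotion 𝓕 P B) (hst : s ≤ t)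
    (hξ : Measurable[𝓕 s] ξ) : ∫ ω, ξ ω * (B t ω - B s ω) ∂P = 0 := by
  rw [(h.indepFun hst hξ).integral_fun_mul_eq_mul_integral
    (hξ.mono (𝓕.le s) le_rfl).aestronglyMeasurable
    ((h.measurable t).sub (h.measurable s)).aestronglyMeasurable]
  have := (h.hasLaw_increment hst).integral_eq
  rw [this, integral_id_gaussianReal, mul_zero]

lemma integral_mul_increment_sq (h : IsScalarBrownianMotion 𝓕 P B) (hst : s ≤ t)
    (hξ : Measurable[𝓕 s] ξ) :
    ∫ ω, ξ ω * (B t ω - B s ω) ^ 2 ∂P = (∫ ω, ξ ω ∂P) * (t - s : ℝ≥0) := by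
  have hi : IndepFun ξ (fun ω => (B t ω - B s ω) ^ 2) P :=
    (h.indepFun hst hξ).comp measurable_id (measurable_id.pow_const 2)
  rw [hi.integral_fun_mul_eq_mul_integral
    (hξ.mono (𝓕.le s) le_rfl).aestronglyMeasurable
    (((h.measurable t).sub (h.measurable s)).pow_const 2).aestronglyMeasurable]
  have hl := h.hasLaw_increment hst
  have h1 := variance_id_gaussianReal (μ := 0) (v := t - s)
  rw [variance_eq_integral (by fun_prop)] at h1
  have h2 := hl.integral_comp (f := fun x => x ^ 2) (by fun_prop)
  simp only [id, integral_id_gaussianReal, sub_zero] at h1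
  rw [h1] at h2
  rw [← h2]; rfl

/-- The past is independent of an increment, so no more than square integrability of the
coefficient is needed. -/
lemma memLp_mul_increment (h : IsScalarBrownianMotion 𝓕 P B) (hst : s ≤ t)
    (hξ : Measurable[𝓕 s] ξ) (hξ2 : MemLp ξ 2 P) :
    MemLp (fun ω => ξ ω * (B t ω - B s ω)) 2 P := by
  have hm := hξ.mono (𝓕.le s) le_rfl
  have hmB := (h.measurable t).sub (h.measurable s)
  refine (memLp_two_iff_integrable_sq (hm.mul hmB).aestronglyMeasurable).2 ?_
  have hi : IndepFun (fun ω => ξ ω ^ 2) (fun ω => (B t ω - B s ω) ^ 2) P :=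
    (h.indepFun hst hξ).comp (measurable_id.pow_const 2) (measurable_id.pow_const 2)
  have := hi.integrable_mul hξ2.integrable_sq (h.memLp_increment s t 2).integrable_sq
  refine this.congr (ae_of_all _ fun ω => ?_)
  simp [mul_pow]

/-- The overlap `max (min t t' - max s s') 0` is the length of `(s, t] ∩ (s', t']`. -/
lemma integral_mul_increment_mul (h : IsScalarBrownianMotion 𝓕 P B) (hst : s ≤ t) (hst' : s' ≤ t')
    (hξ : Measurable[𝓕 s] ξ) (hξ2 : MemLp ξ 2 P)
    (hξ' : Measurable[𝓕 s'] ξ') (hξ2' : MemLp ξ' 2 P) :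
    ∫ ω, (ξ ω * (B t ω - B s ω)) * (ξ' ω * (B t' ω - B s' ω)) ∂P =
      (∫ ω, ξ ω * ξ' ω ∂P) * max (min (t : ℝ) t' - max (s : ℝ) s') 0 := by
  wlog hss : s ≤ s' generalizing s t s' t' ξ ξ'
  · have := this hst' hst hξ' hξ2' hξ hξ2 (le_of_not_ge hss)
    rw [min_comm, max_comm (s : ℝ)]
    simp only [mul_comm (ξ _)] at this ⊢
    rw [← this]
    congr 1; ext ω; ring
  have hss1 : (s : ℝ) ≤ s' := hss
  have hst1 : (s : ℝ) ≤ t := hst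
  have hst1' : (s' : ℝ) ≤ t' := hst'
  rcases le_total t s' with hts | hts
  · have h1 : (t : ℝ) ≤ s' := hts
    rw [max_eq_right (b := (0 : ℝ)), mul_zero]
    · have hZ : Measurable[𝓕 s'] fun ω => ξ ω * (B t ω - B s ω) * ξ' ω :=
        ((hξ.mono (𝓕.mono hss) le_rfl).mul (((h.adapted t).mono (𝓕.mono hts) le_rfl).sub
          ((h.adapted s).mono (𝓕.mono hss) le_rfl))).mul hξ'
      rw [← h.integral_mul_increment hst' hZ]
      congr 1; ext ω; ring
    · rw [max_eq_right hss1, sub_nonpos]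
      exact (min_le_left _ _).trans h1
  have hts1 : (s' : ℝ) ≤ t := hts
  have hξs' := hξ.mono (𝓕.mono hss) (le_refl (borel ℝ))
  have aux : ∀ {u : ℝ≥0} {η : Ω → ℝ}, s' ≤ u → Measurable[𝓕 s'] η →
      Measurable[𝓕 u] fun ω => η ω * (B u ω - B s' ω) := fun hu hη =>
    (hη.mono (𝓕.mono hu) le_rfl).mul ((h.adapted _).sub ((h.adapted s').mono (𝓕.mono hu) le_rfl))
  have hξξ : Measurable[𝓕 s'] fun ω => ξ ω * ξ' ω := hξs'.mul hξ'
  -- the part of the first increment before `s'` is uncorrelated with the second increment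
  have e1 : ∫ ω, (ξ ω * (B s' ω - B s ω)) * (ξ' ω * (B t' ω - B s' ω)) ∂P = 0 := by
    have hZ : Measurable[𝓕 s'] fun ω => ξ ω * (B s' ω - B s ω) * ξ' ω :=
      (hξs'.mul ((h.adapted s').sub ((h.adapted s).mono (𝓕.mono hss) le_rfl))).mul hξ'
    rw [← h.integral_mul_increment hst' hZ]
    congr 1; ext ω; ring
  have i1 := (h.memLp_mul_increment hss hξ hξ2).integrable_mul
    (h.memLp_mul_increment hst' hξ' hξ2')
  rw [max_eq_right hss1]
  rcases le_total t t' with htt | htt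
  · have h1 : (t : ℝ) ≤ t' := htt
    rw [min_eq_left h1, max_eq_left (sub_nonneg.2 hts1)]
    have e2 : ∫ ω, (ξ ω * (B t ω - B s' ω)) * (ξ' ω * (B t ω - B s' ω)) ∂P =
        (∫ ω, ξ ω * ξ' ω ∂P) * (t - s') := by
      rw [← NNReal.coe_sub hts, ← h.integral_mul_increment_sq hts hξξ]
      congr 1; ext ω; ring
    have e3 : ∫ ω, (ξ ω * (B t ω - B s' ω)) * (ξ' ω * (B t' ω - B t ω)) ∂P = 0 := by
      rw [← h.integral_mul_increment htt (aux hts hξξ)]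
      congr 1; ext ω; ring
    have m2 := h.memLp_mul_increment hts hξs' hξ2
    have i2 := m2.integrable_mul (h.memLp_mul_increment hts hξ' hξ2')
    have i3 := m2.integrable_mul
      (h.memLp_mul_increment htt (hξ'.mono (𝓕.mono hts) le_rfl) hξ2')
    have := integral_add i1 (i2.add i3)
    rw [integral_add' i2 i3] at this
    simp only [Pi.mul_apply, Pi.add_apply] at this
    rw [e1, e2, e3, zero_add, add_zero] at this
    rw [← this]
    congr 1; ext ω; ring
  · have h1 : (t' : ℝ) ≤ t := htt
    rw [min_eq_right h1, max_eq_left (sub_nonneg.2 hst1')]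
    have e2 : ∫ ω, (ξ ω * (B t' ω - B s' ω)) * (ξ' ω * (B t' ω - B s' ω)) ∂P =
        (∫ ω, ξ ω * ξ' ω ∂P) * (t' - s') := by
      rw [← NNReal.coe_sub hst', ← h.integral_mul_increment_sq hst' hξξ]
      congr 1; ext ω; ring
    have e3 : ∫ ω, (ξ ω * (B t ω - B t' ω)) * (ξ' ω * (B t' ω - B s' ω)) ∂P = 0 := by
      rw [← h.integral_mul_increment htt (aux hst' hξξ)]
      congr 1; ext ω; ring
    have m2 := h.memLp_mul_increment hst' hξ' hξ2'
    have i2 := (h.memLp_mul_increment hst' hξs' hξ2).integrable_mul m2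
    have i3 := (h.memLp_mul_increment htt (hξs'.mono (𝓕.mono hst') le_rfl) hξ2).integrable_mul m2
    have := integral_add i1 (i2.add i3)
    rw [integral_add' i2 i3] at this
    simp only [Pi.mul_apply, Pi.add_apply] at this
    rw [e1, e2, e3, zero_add, add_zero] at this
    rw [← this]
    congr 1; ext ω; ring

end IsScalarBrownianMotion

end

/-! ### The Itô isometry for finite sums of increments -/

section

variable {Ω : Type*} [mΩ : MeasurableSpace Ω]

lemma lintegral_toNNReal_indicator_mul (x y : ℝ) {a b s t s' t' : ℝ≥0} (ha : a ≤ s) (hb : t ≤ b) :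
    Integrable (fun τ : ℝ => (Set.Ioc s t).indicator (fun _ => x) τ.toNNReal *
        (Set.Ioc s' t').indicator (fun _ => y) τ.toNNReal) (volume.restrict (Set.Icc (a : ℝ) b)) ∧
    ∫ τ in Set.Icc (a : ℝ) b, (Set.Ioc s t).indicator (fun _ => x) τ.toNNReal *
        (Set.Ioc s' t').indicator (fun _ => y) τ.toNNReal =
      x * y * max (min (t : ℝ) t' - max (s : ℝ) s') 0 := by
  have e : (fun τ : ℝ => (Set.Ioc s t).indicator (fun _ => x) τ.toNNReal *
        (Set.Ioc s' t').indicator (fun _ => y) τ.toNNReal) =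
      (Set.Ioc (max (s : ℝ) s') (min (t : ℝ) t')).indicator fun _ => x * y := by
    ext τ
    have key : ∀ u v : ℝ≥0, τ.toNNReal ∈ Set.Ioc u v ↔ τ ∈ Set.Ioc (u : ℝ) v := fun u v => by
      rw [Set.mem_Ioc, Set.mem_Ioc, Real.toNNReal_le_iff_le_coe, Real.lt_toNNReal_iff_coe_lt]
    rw [← Set.Ioc_inter_Ioc]
    simp only [Set.indicator_apply, key]
    by_cases h1 : τ ∈ Set.Ioc (s : ℝ) t <;> by_cases h2 : τ ∈ Set.Ioc (s' : ℝ) t' <;>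
      simp [h1, h2, Set.mem_inter_iff]
  rw [e]
  refine ⟨(integrable_const _).indicator measurableSet_Ioc, ?_⟩
  rw [integral_indicator measurableSet_Ioc, setIntegral_const,
    measureReal_restrict_apply measurableSet_Ioc, Set.inter_eq_left.2, Real.volume_real_Ioc,
    smul_eq_mul, mul_comm]
  refine fun τ hτ => ⟨?_, ?_⟩
  · have : (a : ℝ) ≤ s := ha
    exact this.trans ((le_max_left _ _).trans hτ.1.le)
  · have : (t : ℝ) ≤ b := hb
    exact (hτ.2.trans (min_le_left _ _)).trans this

/-- The Itô isometry for a finite sum of multiples of increments, over intervals in any position. -/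
lemma IsScalarBrownianMotion.lintegral_sum_sq {𝓕 : Filtration ℝ≥0 mΩ} {P : Measure Ω}
    {B : ℝ≥0 → Ω → ℝ} (h : IsScalarBrownianMotion 𝓕 P B) {ι : Type*} (T : Finset ι)
    {s t : ι → ℝ≥0} {ξ : ι → Ω → ℝ} {a b : ℝ≥0}
    (hs : ∀ i ∈ T, a ≤ s i) (hst : ∀ i ∈ T, s i ≤ t i) (ht : ∀ i ∈ T, t i ≤ b)
    (hξ : ∀ i ∈ T, Measurable[𝓕 (s i)] (ξ i)) (hξ2 : ∀ i ∈ T, MemLp (ξ i) 2 P) :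
    ∫⁻ ω, ENNReal.ofReal ((∑ i ∈ T, ξ i ω * (B (t i) ω - B (s i) ω)) ^ 2) ∂P =
      ∫⁻ ω, (∫⁻ τ in Set.Icc (a : ℝ) b, ENNReal.ofReal
        ((∑ i ∈ T, (Set.Ioc (s i) (t i)).indicator (fun _ => ξ i ω) τ.toNNReal) ^ 2)) ∂P := by
  have hint : ∀ i ∈ T, ∀ j ∈ T, Integrable (fun ω => (ξ i ω * (B (t i) ω - B (s i) ω)) *
      (ξ j ω * (B (t j) ω - B (s j) ω))) P := fun i hi j hj =>
    (h.memLp_mul_increment (hst i hi) (hξ i hi) (hξ2 i hi)).integrable_mul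
      (h.memLp_mul_increment (hst j hj) (hξ j hj) (hξ2 j hj))
  have hint' : ∀ i ∈ T, ∀ j ∈ T, Integrable (fun ω => ξ i ω * ξ j ω *
      max (min (t i : ℝ) (t j) - max (s i : ℝ) (s j)) 0) P := fun i hi j hj =>
    ((hξ2 i hi).integrable_mul (hξ2 j hj)).mul_const _
  have inner : ∀ ω, (∫⁻ τ in Set.Icc (a : ℝ) b, ENNReal.ofReal
        ((∑ i ∈ T, (Set.Ioc (s i) (t i)).indicator (fun _ => ξ i ω) τ.toNNReal) ^ 2)) =
      ENNReal.ofReal (∑ i ∈ T, ∑ j ∈ T, ξ i ω * ξ j ω *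
        max (min (t i : ℝ) (t j) - max (s i : ℝ) (s j)) 0) := by
    intro ω
    have hi := fun i (hi : i ∈ T) j => lintegral_toNNReal_indicator_mul (ξ i ω) (ξ j ω)
      (s' := s j) (t' := t j) (hs i hi) (ht i hi)
    rw [← ofReal_integral_eq_lintegral_ofReal _ (ae_of_all _ fun τ => sq_nonneg _)]
    · congr 1
      simp only [pow_two, Finset.sum_mul_sum]
      rw [integral_finsetSum _ fun i hiT => integrable_finsetSum _ fun j _ => (hi i hiT j).1]
      refine Finset.sum_congr rfl fun i hiT => ?_
      rw [integral_finsetSum _ fun j _ => (hi i hiT j).1]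
      exact Finset.sum_congr rfl fun j _ => (hi i hiT j).2
    · simp only [pow_two, Finset.sum_mul_sum]
      exact integrable_finsetSum _ fun i hiT => integrable_finsetSum _ fun j _ => (hi i hiT j).1
  have inner_nonneg : ∀ ω, 0 ≤ ∑ i ∈ T, ∑ j ∈ T, ξ i ω * ξ j ω *
        max (min (t i : ℝ) (t j) - max (s i : ℝ) (s j)) 0 := by
    intro ω
    have hi := fun i (hi : i ∈ T) j => lintegral_toNNReal_indicator_mul (ξ i ω) (ξ j ω)
      (s' := s j) (t' := t j) (hs i hi) (ht i hi)
    have : ∑ i ∈ T, ∑ j ∈ T, ξ i ω * ξ j ω *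
        max (min (t i : ℝ) (t j) - max (s i : ℝ) (s j)) 0 = ∫ τ in Set.Icc (a : ℝ) b,
        (∑ i ∈ T, (Set.Ioc (s i) (t i)).indicator (fun _ => ξ i ω) τ.toNNReal) ^ 2 := by
      simp only [pow_two, Finset.sum_mul_sum]
      rw [integral_finsetSum _ fun i hiT => integrable_finsetSum _ fun j _ => (hi i hiT j).1]
      refine Finset.sum_congr rfl fun i hiT => ?_
      rw [integral_finsetSum _ fun j _ => (hi i hiT j).1]
      exact Finset.sum_congr rfl fun j _ => (hi i hiT j).2.symm
    rw [this]
    exact integral_nonneg fun τ => sq_nonneg _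
  simp only [inner]
  simp only [pow_two, Finset.sum_mul_sum]
  rw [← ofReal_integral_eq_lintegral_ofReal, ← ofReal_integral_eq_lintegral_ofReal]
  · congr 1
    rw [integral_finsetSum _ fun i hi => integrable_finsetSum _ fun j hj => hint i hi j hj,
      integral_finsetSum _ fun i hi => integrable_finsetSum _ fun j hj => hint' i hi j hj]
    refine Finset.sum_congr rfl fun i hi => ?_
    rw [integral_finsetSum _ fun j hj => hint i hi j hj,
      integral_finsetSum _ fun j hj => hint' i hi j hj]
    refine Finset.sum_congr rfl fun j hj => ?_
    rw [h.integral_mul_increment_mul (hst i hi) (hst j hj) (hξ i hi) (hξ2 i hi) (hξ j hj)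
      (hξ2 j hj), integral_mul_const]
  · exact integrable_finsetSum _ fun i hi => integrable_finsetSum _ fun j hj => hint' i hi j hj
  · exact ae_of_all _ inner_nonneg
  · exact integrable_finsetSum _ fun i hi => integrable_finsetSum _ fun j hj => hint i hi j hj
  · refine ae_of_all _ fun ω => ?_
    simp only [← Finset.sum_mul_sum]
    exact mul_self_nonneg _

namespace SimpleProcess

variable {𝓕 : Filtration ℝ≥0 mΩ} {P : Measure Ω} {a b : ℝ≥0}

lemma le_time (S : SimpleProcess 𝓕 P a b) (j : ℕ) : a ≤ S.time j :=
  S.time_zero.symm.trans_le (S.monotone_time (Nat.zero_le j))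

lemma time_succ_le (S : SimpleProcess 𝓕 P a b) {j : ℕ} (hj : j < S.n) : S.time (j + 1) ≤ b :=
  (S.monotone_time hj).trans_eq S.time_last

lemma memLp_integral (S : SimpleProcess 𝓕 P a b) {B : ℝ≥0 → Ω → ℝ}
    (h : IsScalarBrownianMotion 𝓕 P B) : MemLp (S.integral B) 2 P :=
  memLp_finsetSum _ fun j _ => h.memLp_mul_increment (S.monotone_time (Nat.le_succ j))
    (S.measurable_coef j) (S.memLp_coef j)

/-- The Itô isometry for the difference of two simple processes. -/
lemma lintegral_integral_sub_sq (S S' : SimpleProcess 𝓕 P a b) {B : ℝ≥0 → Ω → ℝ}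
    (h : IsScalarBrownianMotion 𝓕 P B) :
    ∫⁻ ω, ENNReal.ofReal ((S.integral B ω - S'.integral B ω) ^ 2) ∂P =
      ∫⁻ ω, (∫⁻ τ in Set.Icc (a : ℝ) b, ENNReal.ofReal
        ((S.eval τ.toNNReal ω - S'.eval τ.toNNReal ω) ^ 2)) ∂P := by
  have := h.lintegral_sum_sq ((Finset.range S.n).disjSum (Finset.range S'.n)) (a := a) (b := b)
    (s := Sum.elim S.time S'.time)
    (t := Sum.elim (fun j => S.time (j + 1)) (fun j => S'.time (j + 1)))
    (ξ := Sum.elim S.coef (fun j => - S'.coef j))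
    (by
      rintro (j | j) _
      · exact S.le_time j
      · exact S'.le_time j)
    (by
      rintro (j | j) _
      · exact S.monotone_time (Nat.le_succ j)
      · exact S'.monotone_time (Nat.le_succ j))
    (by
      rintro (j | j) hj
      · exact S.time_succ_le (by simpa using hj)
      · exact S'.time_succ_le (by simpa using hj))
    (by
      rintro (j | j) _
      · exact S.measurable_coef j
      · exact (S'.measurable_coef j).neg)
    (by
      rintro (j | j) _
      · exact S.memLp_coef j
      · exact (S'.memLp_coef j).neg)
  simp only [Finset.sum_disjSum, Sum.elim_inl, Sum.elim_inr, Pi.neg_apply, neg_mul,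
    Finset.sum_neg_distrib, ← sub_eq_add_neg] at this
  have e : ∀ ω (τ : ℝ), ∑ j ∈ Finset.range S'.n,
      (Set.Ioc (S'.time j) (S'.time (j + 1))).indicator (fun _ => - S'.coef j ω) τ.toNNReal =
      - S'.eval τ.toNNReal ω := fun ω τ => by
    rw [eval, ← Finset.sum_neg_distrib]
    refine Finset.sum_congr rfl fun j _ => ?_
    simp only [Set.indicator_apply]
    split_ifs <;> simp
  simp only [e, ← sub_eq_add_neg] at this
  exact this

end SimpleProcess

end

/-! ### Approximation of Itô integrals by Riemann sums -/

section

variable {Ω : Type*} [mΩ : MeasurableSpace Ω]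

lemma eLpNorm_two_sq_eq_lintegral (P : Measure Ω) (f : Ω → ℝ) :
    eLpNorm f 2 P ^ 2 = ∫⁻ ω, ENNReal.ofReal (f ω ^ 2) ∂P := by
  have := eLpNorm_nnreal_pow_eq_lintegral (μ := P) (f := f) (p := 2) two_ne_zero
  have e : ((2 : ℝ≥0) : ℝ≥0∞) = 2 := rfl
  have e' : ((2 : ℝ≥0) : ℝ) = ((2 : ℕ) : ℝ) := by norm_num
  rw [e, e', ENNReal.rpow_natCast] at this
  rw [this]
  refine lintegral_congr fun ω => ?_
  rw [ENNReal.rpow_natCast, Real.enorm_eq_ofReal_abs, ← ENNReal.ofReal_pow (abs_nonneg _), sq_abs]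

lemma ofReal_sub_sq_le (x y z : ℝ) : ENNReal.ofReal ((x - y) ^ 2) ≤
    2 * ENNReal.ofReal ((x - z) ^ 2) + 2 * ENNReal.ofReal ((y - z) ^ 2) := by
  have e : (2 : ℝ≥0∞) = ENNReal.ofReal 2 := by simp
  rw [e, ← ENNReal.ofReal_mul zero_le_two, ← ENNReal.ofReal_mul zero_le_two,
    ← ENNReal.ofReal_add (by positivity) (by positivity)]
  exact ENNReal.ofReal_le_ofReal (by nlinarith [sq_nonneg (x + y - 2 * z)])

lemma lintegral_lintegral_const_mul_add {α β : Type*} [MeasurableSpace α] [MeasurableSpace β]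
    {μ : Measure α} {ν : Measure β} [SFinite ν] {c : ℝ≥0∞} (hc : c ≠ ∞) {f : α × β → ℝ≥0∞}
    (hf : Measurable f) (g : α × β → ℝ≥0∞) :
    ∫⁻ x, ∫⁻ y, (c * f (x, y) + c * g (x, y)) ∂ν ∂μ =
      c * (∫⁻ x, ∫⁻ y, f (x, y) ∂ν ∂μ) + c * (∫⁻ x, ∫⁻ y, g (x, y) ∂ν ∂μ) := by
  have h1 : ∀ x, ∫⁻ y, (c * f (x, y) + c * g (x, y)) ∂ν =
      c * (∫⁻ y, f (x, y) ∂ν) + c * (∫⁻ y, g (x, y) ∂ν) := fun x => by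
    have h2 : Measurable fun y => f (x, y) := hf.comp measurable_prodMk_left
    rw [lintegral_add_left (h2.const_mul c),
      lintegral_const_mul' _ _ hc, lintegral_const_mul' _ _ hc]
  simp only [h1]
  rw [lintegral_add_left (hf.lintegral_prod_right'.const_mul c),
    lintegral_const_mul' _ _ hc, lintegral_const_mul' _ _ hc]

/-- The exceptional null set of discontinuous paths makes a Brownian motion only almost jointly
measurable; setting the path to zero there repairs this. -/
lemma IsScalarBrownianMotion.exists_measurable_modification {𝓕 : Filtration ℝ≥0 mΩ}
    {P : Measure Ω} {H : ℝ≥0 → Ω → ℝ} (h : IsScalarBrownianMotion 𝓕 P H) :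
    ∃ H' : ℝ≥0 → Ω → ℝ, Measurable (Function.uncurry H') ∧ ∀ᵐ ω ∂P, ∀ t, H' t ω = H t ω := by
  classical
  obtain ⟨N, hN, hNm, hN0⟩ := exists_measurable_superset_of_null (ae_iff.1 h.isBrownianReal.cont)
  refine ⟨fun t ω => if ω ∈ N then 0 else H t ω, ?_, ?_⟩
  · refine measurable_uncurry_of_continuous_of_measurable (fun ω => ?_) fun t => ?_
    · by_cases hω : ω ∈ N
      · simpa [hω] using continuous_const
      · simp only [hω, if_false]
        exact not_not.1 fun hc => hω (hN hc)
    · exact Measurable.ite hNm measurable_const (h.measurable t)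
  · filter_upwards [measure_eq_zero_iff_ae_notMem.1 hN0] with ω hω t
    simp [hω]

namespace SimpleProcess

variable {𝓕 : Filtration ℝ≥0 mΩ} {P : Measure Ω} {a b : ℝ≥0}

/-- The squared distance `E ∫_a^b (S_t - H_t)² dt` of a simple process to a process `H`. -/
noncomputable def sqDist (S : SimpleProcess 𝓕 P a b) (H : ℝ≥0 → Ω → ℝ) : ℝ≥0∞ :=
  ∫⁻ ω, (∫⁻ t in Set.Icc (a : ℝ) b,
      ENNReal.ofReal ((S.eval t.toNNReal ω - H t.toNNReal ω) ^ 2)) ∂P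

lemma measurable_eval (S : SimpleProcess 𝓕 P a b) :
    Measurable fun x : Ω × ℝ => S.eval x.2.toNNReal x.1 := by
  refine Finset.measurable_fun_sum _ fun j _ => ?_
  have e : (fun x : Ω × ℝ => (Set.Ioc (S.time j) (S.time (j + 1))).indicator
      (fun _ => S.coef j x.1) x.2.toNNReal) =
      ((fun x : Ω × ℝ => x.2.toNNReal) ⁻¹' Set.Ioc (S.time j) (S.time (j + 1))).indicator
        fun x => S.coef j x.1 := by
    ext x
    rfl
  rw [e]
  have hc : Measurable (S.coef j) := (S.measurable_coef j).mono (𝓕.le _) le_rfl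
  exact (hc.comp measurable_fst).indicator
    (measurableSet_Ioc.preimage (measurable_real_toNNReal.comp measurable_snd))

lemma sqDist_congr (S : SimpleProcess 𝓕 P a b) {H H' : ℝ≥0 → Ω → ℝ}
    (h : ∀ᵐ ω ∂P, ∀ t, H' t ω = H t ω) : S.sqDist H' = S.sqDist H := by
  refine lintegral_congr_ae ?_
  filter_upwards [h] with ω hω
  simp only [hω]

/-- Itô's isometry and the triangle inequality: simple processes close to the same `H` have
close integrals. -/
lemma eLpNorm_integral_sub_sq_le [IsProbabilityMeasure P] (S S' : SimpleProcess 𝓕 P a b)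
    {B H : ℝ≥0 → Ω → ℝ} (hB : IsScalarBrownianMotion 𝓕 P B) (hH : IsScalarBrownianMotion 𝓕 P H) :
    eLpNorm (fun ω => S.integral B ω - S'.integral B ω) 2 P ^ 2 ≤
      2 * S.sqDist H + 2 * S'.sqDist H := by
  obtain ⟨H', hm, hae⟩ := hH.exists_measurable_modification
  rw [eLpNorm_two_sq_eq_lintegral, S.lintegral_integral_sub_sq S' hB, ← S.sqDist_congr hae,
    ← S'.sqDist_congr hae]
  have hmS : ∀ S : SimpleProcess 𝓕 P a b, Measurable fun x : Ω × ℝ =>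
      ENNReal.ofReal ((S.eval x.2.toNNReal x.1 - H' x.2.toNNReal x.1) ^ 2) := fun S =>
    ((S.measurable_eval.sub (hm.comp ((measurable_real_toNNReal.comp
      measurable_snd).prodMk measurable_fst))).pow_const 2).ennreal_ofReal
  calc _ ≤ ∫⁻ ω, (∫⁻ τ in Set.Icc (a : ℝ) b,
        (2 * ENNReal.ofReal ((S.eval τ.toNNReal ω - H' τ.toNNReal ω) ^ 2) +
          2 * ENNReal.ofReal ((S'.eval τ.toNNReal ω - H' τ.toNNReal ω) ^ 2))) ∂P :=
        lintegral_mono fun ω => lintegral_mono fun τ => ofReal_sub_sq_le _ _ _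
    _ = _ := lintegral_lintegral_const_mul_add (by simp) (hmS S)
        fun x => ENNReal.ofReal ((S'.eval x.2.toNNReal x.1 - H' x.2.toNNReal x.1) ^ 2)

lemma exists_eval_eq (S : SimpleProcess 𝓕 P a b) {t : ℝ≥0} (ht : t ∈ Set.Ioc a b) :
    ∃ j < S.n, t ∈ Set.Ioc (S.time j) (S.time (j + 1)) ∧ ∀ ω, S.eval t ω = S.coef j ω := by
  have hu := S.monotone_time.biUnion_Ico_Ioc_map_succ 0 S.n
  rw [S.time_zero, S.time_last] at hu
  rw [← hu] at ht
  simp only [Set.mem_iUnion, Set.mem_Ico, Nat.zero_le, true_and, exists_prop] at ht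
  obtain ⟨j, hj, hjt⟩ := ht
  refine ⟨j, hj, hjt, fun ω => ?_⟩
  rw [eval, Finset.sum_eq_single j]
  · exact Set.indicator_of_mem hjt _
  · intro i _ hij
    refine Set.indicator_of_notMem (fun hi => ?_) _
    exact Set.disjoint_left.1 (S.monotone_time.pairwise_disjoint_on_Ioc_succ hij) hi hjt
  · intro h
    exact absurd (Finset.mem_range.2 hj) h

end SimpleProcess

/-- The `j`-th point of the uniform partition of `[a, a + L]` into `n` intervals. -/
noncomputable def gridPoint (a L : ℝ≥0) (n j : ℕ) : ℝ≥0 := a + L * (j / n)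

/-- The simple process that follows `H` along the uniform partition of `[a, a + L]` into `n`
intervals: its integrals are the left-endpoint Riemann sums. -/
noncomputable def riemannProcess {𝓕 : Filtration ℝ≥0 mΩ} {P : Measure Ω} {H : ℝ≥0 → Ω → ℝ}
    (hH : IsScalarBrownianMotion 𝓕 P H) (a L : ℝ≥0) {b : ℝ≥0} (hb : b = a + L) (n : ℕ) [NeZero n] :
    SimpleProcess 𝓕 P a b where
  n := n
  time := gridPoint a L n
  monotone_time i j hij := by unfold gridPoint; gcongr
  time_zero := by simp [gridPoint]
  time_last := by simp [gridPoint, hb, NeZero.ne n]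
  coef j := H (gridPoint a L n j)
  measurable_coef j := hH.adapted _
  memLp_coef j := hH.memLp_eval _ 2

variable {𝓕 : Filtration ℝ≥0 mΩ} {P : Measure Ω} {H B : ℝ≥0 → Ω → ℝ}

lemma IsScalarBrownianMotion.lintegral_increment_sq [IsProbabilityMeasure P]
    (h : IsScalarBrownianMotion 𝓕 P H) {s t : ℝ≥0} (hst : s ≤ t) :
    ∫⁻ ω, ENNReal.ofReal ((H s ω - H t ω) ^ 2) ∂P = (t - s : ℝ≥0) := by
  rw [← ofReal_integral_eq_lintegral_ofReal _ (ae_of_all _ fun _ => sq_nonneg _)]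
  · have := h.integral_mul_increment_sq hst (ξ := fun _ => 1) measurable_const
    simp only [one_mul, integral_const, probReal_univ, smul_eq_mul] at this
    rw [← ENNReal.ofReal_coe_nnreal, ← this]
    congr 2; ext ω; ring
  · exact (h.memLp_increment t s 2).integrable_sq

lemma sqDist_riemannProcess_le [IsProbabilityMeasure P] (hH : IsScalarBrownianMotion 𝓕 P H)
    (a L : ℝ≥0) {b : ℝ≥0} (hb : b = a + L) (n : ℕ) [NeZero n] :
    (riemannProcess hH a L hb n).sqDist H ≤ ((L / n * L : ℝ≥0) : ℝ≥0∞) := by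
  obtain ⟨H', hm, hae⟩ := hH.exists_measurable_modification
  set S := riemannProcess hH a L hb n with hS
  have hmS : Measurable fun x : Ω × ℝ =>
      ENNReal.ofReal ((S.eval x.2.toNNReal x.1 - H' x.2.toNNReal x.1) ^ 2) :=
    ((S.measurable_eval.sub (hm.comp ((measurable_real_toNNReal.comp
      measurable_snd).prodMk measurable_fst))).pow_const 2).ennreal_ofReal
  rw [← S.sqDist_congr hae, SimpleProcess.sqDist, lintegral_lintegral_swap hmS.aemeasurable]
  have hbound : ∀ τ ∈ Set.Ioc (a : ℝ) b,
      ∫⁻ ω, ENNReal.ofReal ((S.eval τ.toNNReal ω - H' τ.toNNReal ω) ^ 2) ∂P ≤ (L / n : ℝ≥0) := by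
    intro τ hτ
    have hτ' : τ.toNNReal ∈ Set.Ioc a b :=
      ⟨Real.lt_toNNReal_iff_coe_lt.2 hτ.1, Real.toNNReal_le_iff_le_coe.2 hτ.2⟩
    obtain ⟨j, hj, hjt, he⟩ := S.exists_eval_eq hτ'
    have : ∫⁻ ω, ENNReal.ofReal ((S.eval τ.toNNReal ω - H' τ.toNNReal ω) ^ 2) ∂P =
        ∫⁻ ω, ENNReal.ofReal ((H (gridPoint a L n j) ω - H τ.toNNReal ω) ^ 2) ∂P := by
      refine lintegral_congr_ae ?_
      filter_upwards [hae] with ω hω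
      rw [hω, he]; rfl
    have hle : gridPoint a L n j ≤ τ.toNNReal := hjt.1.le
    rw [this, hH.lintegral_increment_sq hle, ENNReal.coe_le_coe, tsub_le_iff_left]
    refine hjt.2.trans (le_of_eq ?_)
    change gridPoint a L n (j + 1) = gridPoint a L n j + L / n
    simp only [gridPoint]; push_cast; ring
  rw [restrict_Ioc_eq_restrict_Icc.symm]
  calc _ ≤ ∫⁻ τ in Set.Ioc (a : ℝ) b, ((L / n : ℝ≥0) : ℝ≥0∞) :=
        setLIntegral_mono measurable_const hbound
    _ = _ := by
        rw [setLIntegral_const, Real.volume_Ioc, ENNReal.coe_mul, hb]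
        congr 1
        rw [NNReal.coe_add, add_sub_cancel_left, ENNReal.ofReal_coe_nnreal]

lemma tendsto_zero_of_sq {u : ℕ → ℝ≥0∞} (h : Tendsto (fun n => u n ^ 2) atTop (𝓝 0)) :
    Tendsto u atTop (𝓝 0) := by
  have := (ENNReal.continuous_rpow_const (y := (1 / 2 : ℝ))).tendsto 0 |>.comp h
  rw [ENNReal.zero_rpow_of_pos (by norm_num)] at this
  refine this.congr fun n => ?_
  simp only [Function.comp]
  rw [← ENNReal.rpow_natCast, ← ENNReal.rpow_mul]
  norm_num

/-- Itô integrals are limits of the integrals of any simple processes that approximate the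
integrand, not only of those which witness their existence. -/
lemma IsItoIntegral.tendsto_eLpNorm [IsProbabilityMeasure P] {a b : ℝ≥0} {J : Ω → ℝ}
    (hJ : IsItoIntegral 𝓕 P H B a b J) (hB : IsScalarBrownianMotion 𝓕 P B)
    (hH : IsScalarBrownianMotion 𝓕 P H) {S : ℕ → SimpleProcess 𝓕 P a b}
    (hS : Tendsto (fun n => (S n).sqDist H) atTop (𝓝 0)) :
    Tendsto (fun n => eLpNorm (fun ω => (S n).integral B ω - J ω) 2 P) atTop (𝓝 0) := by
  obtain ⟨hJ2, S', hS', hJ'⟩ := hJ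
  have h1 : Tendsto (fun n => eLpNorm (fun ω => (S n).integral B ω - (S' n).integral B ω) 2 P)
      atTop (𝓝 0) := by
    refine tendsto_zero_of_sq (tendsto_of_tendsto_of_tendsto_of_le_of_le tendsto_const_nhds ?_
      (fun _ => zero_le) fun n => (S n).eLpNorm_integral_sub_sq_le (S' n) hB hH)
    have := (ENNReal.Tendsto.const_mul hS (a := 2) (by simp)).add
      (ENNReal.Tendsto.const_mul (a := 2) hS' (by simp))
    simpa [SimpleProcess.sqDist] using this
  have h2 := h1.add hJ'
  rw [add_zero] at h2
  refine tendsto_of_tendsto_of_tendsto_of_le_of_le tendsto_const_nhds h2 (fun _ => zero_le)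
    fun n => ?_
  have e : (fun ω => (S n).integral B ω - J ω) =
      (fun ω => (S n).integral B ω - (S' n).integral B ω) + fun ω => (S' n).integral B ω - J ω := by
    ext ω; simp
  have m := (S n).memLp_integral hB
  have m' := (S' n).memLp_integral hB
  beta_reduce
  rw [e]
  exact eLpNorm_add_le (m.sub m').1 (m'.sub hJ2).1 one_le_two

end

/-! ### Exponential moments of Riemann sums -/

section

variable {Ω : Type*} [mΩ : MeasurableSpace Ω] {𝓕 : Filtration ℝ≥0 mΩ} {P : Measure Ω}
  {H B : ℝ≥0 → Ω → ℝ}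

lemma lintegral_exp_gaussianReal (v : ℝ≥0) (c : ℝ) :
    ∫⁻ x, ENNReal.ofReal (Real.exp (c * x - c ^ 2 * v / 2)) ∂gaussianReal 0 v = 1 := by
  have h1 := integrable_exp_mul_gaussianReal (μ := 0) (v := v) c
  have h2 := congrFun (mgf_fun_id_gaussianReal (μ := 0) (v := v)) c
  rw [mgf] at h2
  have e : ∀ x : ℝ, Real.exp (c * x - c ^ 2 * v / 2) =
      Real.exp (c * x) * Real.exp (-(c ^ 2 * v / 2)) := fun x => by
    rw [← Real.exp_add]; ring_nf
  simp only [e]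
  rw [← ofReal_integral_eq_lintegral_ofReal (h1.mul_const _)
    (ae_of_all _ fun x => by positivity), integral_mul_const, h2, ← Real.exp_add]
  rw [← ENNReal.ofReal_one, ← Real.exp_zero]
  congr 2; ring

lemma exists_lintegral_exp_sq_gaussianReal_le : ∃ C : ℝ≥0∞, C ≠ ∞ ∧ ∀ (v : ℝ≥0) (c : ℝ),
    c * v ≤ 1 / 4 → ∫⁻ x, ENNReal.ofReal (Real.exp (c * x ^ 2)) ∂gaussianReal 0 v ≤ C := by
  refine ⟨∫⁻ x, ENNReal.ofReal (Real.exp (1 / 4 * x ^ 2)) ∂gaussianReal 0 1, ?_, fun v c h => ?_⟩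
  · rw [gaussianReal_of_var_ne_zero _ one_ne_zero,
      lintegral_withDensity_eq_lintegral_mul _ (measurable_gaussianPDF _ _) (by fun_prop)]
    have hi := (integrable_exp_neg_mul_sq (b := 1 / 4) (by norm_num)).const_mul
      (√(2 * Real.pi * (1 : ℝ≥0)))⁻¹
    rw [← lt_top_iff_ne_top]
    refine lt_of_le_of_lt (le_of_eq ?_) hi.lintegral_lt_top
    refine lintegral_congr fun x => ?_
    simp only [Pi.mul_apply, gaussianPDF, gaussianPDFReal]
    rw [← ENNReal.ofReal_mul (by positivity), mul_assoc, ← Real.exp_add]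
    congr 3
    simp only [NNReal.coe_one]; ring
  · have e : gaussianReal 0 v = (gaussianReal 0 1).map (√v * ·) := by
      rw [gaussianReal_map_const_mul]
      congr 1
      · simp
      · ext; simp
    rw [e, lintegral_map (by fun_prop) (by fun_prop)]
    refine lintegral_mono fun x => ENNReal.ofReal_le_ofReal (Real.exp_le_exp.2 ?_)
    rw [mul_pow, Real.sq_sqrt (NNReal.coe_nonneg v), ← mul_assoc]
    exact mul_le_mul_of_nonneg_right h (sq_nonneg x)

/-- The exponential martingale step: an increment after time `s` with coefficient `Y` known at
time `s`, compensated by half its conditional variance, does not change the expectation. -/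
lemma IsScalarBrownianMotion.lintegral_mul_exp_increment [IsProbabilityMeasure P]
    (h : IsScalarBrownianMotion 𝓕 P B)
    {s t : ℝ≥0} (hst : s ≤ t) {Z : Ω → ℝ≥0∞} {Y : Ω → ℝ} (hZ : Measurable[𝓕 s] Z)
    (hY : Measurable[𝓕 s] Y) :
    ∫⁻ ω, Z ω * ENNReal.ofReal
      (Real.exp (Y ω * (B t ω - B s ω) - Y ω ^ 2 * (t - s : ℝ≥0) / 2)) ∂P = ∫⁻ ω, Z ω ∂P := by
  have hZm : Measurable Z := hZ.mono (𝓕.le s) le_rfl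
  have hYm : Measurable Y := hY.mono (𝓕.le s) le_rfl
  have hBm : Measurable fun ω => B t ω - B s ω := (h.measurable t).sub (h.measurable s)
  have hi := h.indepFun hst (hZ.prodMk hY)
  rw [indepFun_iff_map_prod_eq_prod_map_map (hZm.prodMk hYm).aemeasurable hBm.aemeasurable,
    (h.hasLaw_increment hst).map_eq] at hi
  have := Measure.isProbabilityMeasure_map (μ := P) (hZm.prodMk hYm).aemeasurable
  let f : (ℝ≥0∞ × ℝ) × ℝ → ℝ≥0∞ := fun x => x.1.1 * ENNReal.ofReal
    (Real.exp (x.1.2 * x.2 - x.1.2 ^ 2 * (t - s : ℝ≥0) / 2))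
  have hf : Measurable f := by fun_prop
  have h1 := lintegral_map hf ((hZm.prodMk hYm).prodMk hBm) (μ := P)
  rw [hi, lintegral_prod _ hf.aemeasurable] at h1
  refine h1.symm.trans ?_
  have h2 : ∀ x : ℝ≥0∞ × ℝ, ∫⁻ y, f (x, y) ∂gaussianReal 0 (t - s) = x.1 := fun x => by
    simp only [f]
    rw [lintegral_const_mul _ (by fun_prop), lintegral_exp_gaussianReal, mul_one]
  simp only [h2]
  rw [lintegral_map measurable_fst (hZm.prodMk hYm)]

/-- The discrete exponential martingale: all its expectations equal one. -/
lemma IsScalarBrownianMotion.lintegral_exp_sum_increment [IsProbabilityMeasure P]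
    (h : IsScalarBrownianMotion 𝓕 P B) {time : ℕ → ℝ≥0} (ht : Monotone time) {Y : ℕ → Ω → ℝ}
    (hY : ∀ j, Measurable[𝓕 (time j)] (Y j)) (n : ℕ) :
    ∫⁻ ω, ENNReal.ofReal (Real.exp (∑ j ∈ Finset.range n,
      (Y j ω * (B (time (j + 1)) ω - B (time j) ω)
        - Y j ω ^ 2 * (time (j + 1) - time j : ℝ≥0) / 2))) ∂P = 1 := by
  induction n with
  | zero => simp
  | succ n ih =>
    rw [← ih]
    simp only [Finset.sum_range_succ, Real.exp_add]
    have hZ : Measurable[𝓕 (time n)] fun ω => ENNReal.ofReal (Real.exp (∑ j ∈ Finset.range n,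
        (Y j ω * (B (time (j + 1)) ω - B (time j) ω)
          - Y j ω ^ 2 * (time (j + 1) - time j : ℝ≥0) / 2))) := by
      refine ENNReal.measurable_ofReal.comp (Real.measurable_exp.comp ?_)
      refine Finset.measurable_fun_sum _ fun j hj => ?_
      have hjn := Finset.mem_range.1 hj
      have m1 : Measurable[𝓕 (time n)] (Y j) := (hY j).mono (𝓕.mono (ht hjn.le)) le_rfl
      have m2 : Measurable[𝓕 (time n)] (B (time j)) :=
        (h.adapted _).mono (𝓕.mono (ht hjn.le)) le_rfl
      have m3 : Measurable[𝓕 (time n)] (B (time (j + 1))) :=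
        (h.adapted _).mono (𝓕.mono (ht hjn)) le_rfl
      exact (m1.mul (m3.sub m2)).sub (((m1.pow_const 2).mul_const _).div_const 2)
    have := h.lintegral_mul_exp_increment (ht (Nat.le_succ n)) hZ (hY n)
    rw [← this]
    refine lintegral_congr fun ω => ?_
    rw [ENNReal.ofReal_mul (Real.exp_pos _).le]

/-- The integrals of the Riemann processes of a Brownian motion have exponential moments near `0`,
bounded uniformly in the mesh. -/
lemma exists_lintegral_exp_riemannProcess_le [IsProbabilityMeasure P]
    (hB : IsScalarBrownianMotion 𝓕 P B)
    (hH : IsScalarBrownianMotion 𝓕 P H) (a L : ℝ≥0) {b : ℝ≥0} (hb : b = a + L) :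
    ∃ ε > 0, ∃ C : ℝ≥0∞, C ≠ ∞ ∧ ∀ c : ℝ, |c| ≤ ε → ∀ n : ℕ, ∀ _ : NeZero n,
      ∫⁻ ω, ENNReal.ofReal (Real.exp (c * (riemannProcess hH a L hb n).integral B ω)) ∂P ≤ C := by
  obtain ⟨C, hC, hCb⟩ := exists_lintegral_exp_sq_gaussianReal_le
  -- `ε` is such that `2 c² L Var(H_t) ≤ 1 / 4` for `|c| ≤ ε` and `t ≤ b`
  set K : ℝ := 8 * (L * b + 1) with hK
  have hKpos : 0 < K := by positivity
  refine ⟨√(1 / K), by positivity, 1 + C, by simp [hC], fun c hc n _ => ?_⟩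
  have hn : (n : ℝ) ≠ 0 := by exact_mod_cast NeZero.ne n
  have hc2 : c ^ 2 * K ≤ 1 := by
    have := pow_le_pow_left₀ (abs_nonneg c) hc 2
    rw [sq_abs, Real.sq_sqrt (by positivity), le_div_iff₀ hKpos] at this
    exact this
  set S := riemannProcess hH a L hb n with hS
  have htime : ∀ j, (S.time (j + 1) - S.time j : ℝ≥0) = L / n := fun j => by
    change gridPoint a L n (j + 1) - gridPoint a L n j = L / n
    have : gridPoint a L n (j + 1) = gridPoint a L n j + L / n := by
      simp only [gridPoint]; push_cast; ring
    rw [this, add_tsub_cancel_left]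
  -- `exp (c R) ≤ exp (2 c R - V) + exp V`, where `V` is `2 c²` times the quadratic variation of `R`
  have hpt : ∀ ω, ENNReal.ofReal (Real.exp (c * S.integral B ω)) ≤
      ENNReal.ofReal (Real.exp (∑ j ∈ Finset.range S.n,
        ((2 * c * S.coef j ω) * (B (S.time (j + 1)) ω - B (S.time j) ω)
          - (2 * c * S.coef j ω) ^ 2 * (S.time (j + 1) - S.time j : ℝ≥0) / 2))) +
      ∑ j ∈ Finset.range n, ENNReal.ofReal (1 / n) *
        ENNReal.ofReal (Real.exp (2 * c ^ 2 * L * H (gridPoint a L n j) ω ^ 2)) := by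
    intro ω
    set V : ℝ := ∑ j ∈ Finset.range n, (1 / n : ℝ) * (2 * c ^ 2 * L * H (gridPoint a L n j) ω ^ 2)
      with hV
    have e1 : ∑ j ∈ Finset.range S.n,
        ((2 * c * S.coef j ω) * (B (S.time (j + 1)) ω - B (S.time j) ω)
          - (2 * c * S.coef j ω) ^ 2 * (S.time (j + 1) - S.time j : ℝ≥0) / 2) =
        2 * (c * S.integral B ω) - V := by
      rw [SimpleProcess.integral, hV, Finset.mul_sum, Finset.mul_sum]
      change _ = _ - ∑ j ∈ Finset.range S.n, _
      rw [← Finset.sum_sub_distrib]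
      refine Finset.sum_congr rfl fun j _ => ?_
      rw [htime]
      change _ = _ - 1 / n * (2 * c ^ 2 * L * S.coef j ω ^ 2)
      push_cast
      ring
    have e2 : Real.exp V ≤ ∑ j ∈ Finset.range n, (1 / n : ℝ) *
        Real.exp (2 * c ^ 2 * L * H (gridPoint a L n j) ω ^ 2) := by
      have := convexOn_exp.map_sum_le (t := Finset.range n) (w := fun _ => (1 / n : ℝ))
        (p := fun j => 2 * c ^ 2 * L * H (gridPoint a L n j) ω ^ 2)
        (fun _ _ => by positivity) (by simp [hn]) (fun _ _ => Set.mem_univ _)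
      simpa only [smul_eq_mul] using this
    have e3 : Real.exp (c * S.integral B ω) ≤
        Real.exp (2 * (c * S.integral B ω) - V) + Real.exp V := by
      rcases le_total (c * S.integral B ω) V with hle | hle
      · exact (Real.exp_le_exp.2 hle).trans (le_add_of_nonneg_left (Real.exp_pos _).le)
      · exact (Real.exp_le_exp.2 (by linarith)).trans (le_add_of_nonneg_right (Real.exp_pos _).le)
    rw [e1]
    simp only [← ENNReal.ofReal_mul (one_div_nonneg.2 (Nat.cast_nonneg (α := ℝ) n))]
    rw [← ENNReal.ofReal_sum_of_nonneg fun _ _ => by positivity,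
      ← ENNReal.ofReal_add (by positivity) (Finset.sum_nonneg fun _ _ => by positivity)]
    exact ENNReal.ofReal_le_ofReal (e3.trans (by gcongr))
  have hmH : ∀ j, Measurable fun ω => ENNReal.ofReal
      (Real.exp (2 * c ^ 2 * L * H (gridPoint a L n j) ω ^ 2)) := fun j => by
    have := hH.measurable (gridPoint a L n j)
    fun_prop
  refine (lintegral_mono hpt).trans ?_
  rw [lintegral_add_right _ (Finset.measurable_fun_sum _ fun j _ => (hmH j).const_mul _)]
  refine add_le_add (le_of_eq ?_) ?_
  · exact hB.lintegral_exp_sum_increment S.monotone_time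
      (fun j => (S.measurable_coef j).const_mul (2 * c)) S.n
  · rw [lintegral_finsetSum _ fun j _ => (hmH j).const_mul _]
    calc _ ≤ ∑ j ∈ Finset.range n, ENNReal.ofReal (1 / n) * C := by
          refine Finset.sum_le_sum fun j hj => ?_
          rw [lintegral_const_mul _ (hmH j)]
          refine mul_le_mul_right ?_ _
          have hl := hH.isBrownianReal.hasLaw_eval (gridPoint a L n j)
          have := hl.lintegral_comp
            (f := fun x => ENNReal.ofReal (Real.exp (2 * c ^ 2 * L * x ^ 2))) (by fun_prop)
          refine this.trans_le (hCb _ _ ?_)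
          have hle : (gridPoint a L n j : ℝ) ≤ b := by
            have h2 : S.time j ≤ b :=
              (S.monotone_time (Finset.mem_range.1 hj).le).trans_eq S.time_last
            exact h2
          have h3 : (2 * c ^ 2 * L) * (gridPoint a L n j : ℝ) ≤ (2 * c ^ 2 * L) * b :=
            mul_le_mul_of_nonneg_left hle (by positivity)
          have h4 := sq_nonneg c
          have h5 : 0 ≤ (L : ℝ) * b := by positivity
          nlinarith
      _ = C := by
          rw [Finset.sum_const, Finset.card_range, nsmul_eq_mul, ← mul_assoc,
            one_div, ENNReal.ofReal_inv_of_pos (by positivity), ENNReal.ofReal_natCast,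
            ENNReal.mul_inv_cancel (by exact_mod_cast NeZero.ne n) (by simp), one_mul]

end

/-! ### Moments of Itô integrals -/

section

variable {Ω : Type*} [mΩ : MeasurableSpace Ω] {𝓕 : Filtration ℝ≥0 mΩ} {P : Measure Ω}
  {H B : ℝ≥0 → Ω → ℝ}

lemma tendsto_sqDist_riemannProcess [IsProbabilityMeasure P] (hH : IsScalarBrownianMotion 𝓕 P H)
    (a L : ℝ≥0) {b : ℝ≥0} (hb : b = a + L) :
    Tendsto (fun N : ℕ => (riemannProcess hH a L hb (4 ^ N)).sqDist H) atTop (𝓝 0) := by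
  refine tendsto_of_tendsto_of_tendsto_of_le_of_le tendsto_const_nhds ?_ (fun _ => zero_le)
    fun N => sqDist_riemannProcess_le hH a L hb (4 ^ N)
  have h : Tendsto (fun N : ℕ => L / ((4 ^ N : ℕ) : ℝ≥0) * L) atTop (𝓝 0) := by
    have := ((tendsto_pow_atTop_nhds_zero_of_lt_one (r := (1 / 4 : ℝ≥0)) (by simp)
      (by rw [div_lt_one] <;> norm_num)).const_mul L).mul_const L
    simp only [mul_zero, zero_mul] at this
    refine this.congr fun N => ?_
    push_cast
    rw [div_pow, one_pow, mul_one_div]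
  simpa only [ENNReal.coe_zero] using ENNReal.tendsto_coe.2 h

/-- Fatou's lemma passes the uniform exponential moments of the Riemann sums on to the integral. -/
lemma IsItoIntegral.memLp [IsProbabilityMeasure P] {a b : ℝ≥0} {J : Ω → ℝ}
    (hJ : IsItoIntegral 𝓕 P H B a b J) (hB : IsScalarBrownianMotion 𝓕 P B)
    (hH : IsScalarBrownianMotion 𝓕 P H) (hab : a ≤ b) (p : ℝ≥0) : MemLp J p P := by
  have hb : b = a + (b - a) := (add_tsub_cancel_of_le hab).symm
  have ht := hJ.tendsto_eLpNorm hB hH (tendsto_sqDist_riemannProcess hH a (b - a) hb)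
  obtain ⟨ε, hε, C, hC, hCb⟩ := exists_lintegral_exp_riemannProcess_le hB hH a (b - a) hb
  have hm := fun N : ℕ => ((riemannProcess hH a (b - a) hb (4 ^ N)).memLp_integral hB).1
  obtain ⟨ns, -, hns⟩ := (tendstoInMeasure_of_tendsto_eLpNorm two_ne_zero
    hm hJ.1.1 ht).exists_seq_tendsto_ae
  have key : ∀ c : ℝ, |c| ≤ ε → c ∈ integrableExpSet J P := by
    intro c hc
    refine ⟨(Real.continuous_exp.comp_aestronglyMeasurable (hJ.1.1.const_mul c)), ?_⟩
    rw [hasFiniteIntegral_iff_ofReal (ae_of_all _ fun _ => (Real.exp_pos _).le)]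
    refine lt_of_le_of_lt ?_ hC.lt_top
    have hl : ∀ᵐ ω ∂P, ENNReal.ofReal (Real.exp (c * J ω)) = liminf (fun n => ENNReal.ofReal
        (Real.exp (c * (riemannProcess hH a (b - a) hb (4 ^ ns n)).integral B ω))) atTop := by
      filter_upwards [hns] with ω hω
      refine (Tendsto.liminf_eq ?_).symm
      exact (ENNReal.continuous_ofReal.comp Real.continuous_exp).continuousAt.tendsto.comp
        (hω.const_mul c)
    rw [lintegral_congr_ae hl]
    refine (lintegral_liminf_le' fun n => ?_).trans ?_
    · exact (Real.continuous_exp.comp_aestronglyMeasurable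
        ((hm (ns n)).const_mul c)).aemeasurable.ennreal_ofReal
    · exact liminf_le_of_le (by isBoundedDefault) fun x hx => by
        obtain ⟨n, hn⟩ := hx.exists
        exact hn.trans (hCb c hc _ inferInstance)
  refine memLp_of_mem_interior_integrableExpSet (mem_interior_iff_mem_nhds.2 ?_) p
  refine Filter.mem_of_superset (Metric.closedBall_mem_nhds 0 hε) fun c hc => key c ?_
  simpa using hc

/-! ### Path space and Brownian scaling -/

/-- The path of a multidimensional process, as a function of the component and the time. -/
def path {ι : Type*} (W : ι → ℝ≥0 → Ω → ℝ) (ω : Ω) : ι × ℝ≥0 → ℝ := fun x => W x.1 x.2 ω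

/-- Brownian scaling by `κ`, as a transformation of paths. -/
noncomputable def scalePath {ι : Type*} (κ : ℕ) (p : ι × ℝ≥0 → ℝ) : ι × ℝ≥0 → ℝ :=
  fun x => (√(κ : ℝ))⁻¹ * p (x.1, κ * x.2)

lemma measurable_scalePath {ι : Type*} (κ : ℕ) : Measurable (scalePath (ι := ι) κ) := by
  unfold scalePath; fun_prop

lemma IsBrownianMotion.measurable_path {ι : Type*} {W : ι → ℝ≥0 → Ω → ℝ}
    (h : IsBrownianMotion 𝓕 P W) : Measurable (path W) :=
  measurable_pi_lambda _ fun x => (h.component x.1).measurable x.2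

/-- Brownian scaling preserves the law of a multidimensional Brownian motion. -/
lemma IsBrownianMotion.map_scalePath {ι : Type*} [Fintype ι] [IsProbabilityMeasure P]
    {W : ι → ℝ≥0 → Ω → ℝ}
    (h : IsBrownianMotion 𝓕 P W) {κ : ℕ} (hκ : κ ≠ 0) :
    P.map (fun ω => scalePath κ (path W ω)) = P.map (path W) := by
  have hmW : ∀ m, Measurable fun ω (t : ℝ≥0) => W m t ω := fun m =>
    measurable_pi_lambda _ fun t => (h.component m).measurable t
  let f : (ℝ≥0 → ℝ) → ℝ≥0 → ℝ := fun g t => (√(κ : ℝ))⁻¹ * g (κ * t)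
  have hf : Measurable f := by fun_prop
  have hfW : ∀ m, Measurable fun ω (t : ℝ≥0) => f (fun t => W m t ω) t := fun m => hf.comp (hmW m)
  have h1 : ∀ m, P.map (fun ω t => f (fun t => W m t ω) t) = P.map (fun ω t => W m t ω) := by
    intro m
    refine (map_eq_iff_forall_finset_map_restrict_eq (X := fun t ω => f (fun t => W m t ω) t)
      (hfW m).aemeasurable (hmW m).aemeasurable).2 fun I => ?_
    have e1 := ((h.isBrownianReal m).smul (c := (κ : ℝ≥0)) (by exact_mod_cast hκ)).hasLaw I
    rw [((h.isBrownianReal m).hasLaw I).map_eq, ← e1.map_eq]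
    simp [f]
  have h2 := h.iIndepFun_components.comp (fun _ => f) fun _ => hf
  have h3 := (iIndepFun_iff_map_fun_eq_pi_map fun m => (hf.comp (hmW m)).aemeasurable).1 h2
  have h4 := (iIndepFun_iff_map_fun_eq_pi_map fun m => (hmW m).aemeasurable).1
    h.iIndepFun_components
  have h5 : P.map (fun ω m => f (fun t => W m t ω)) = P.map (fun ω m t => W m t ω) := by
    rw [h4]
    refine Eq.trans h3 ?_
    congr 1
    exact funext h1
  have h6 := congrArg (Measure.map fun (g : ι → ℝ≥0 → ℝ) (x : ι × ℝ≥0) => g x.1 x.2) h5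
  have hg : Measurable fun (g : ι → ℝ≥0 → ℝ) (x : ι × ℝ≥0) => g x.1 x.2 :=
    measurable_pi_lambda _ fun x => (measurable_pi_apply x.2).comp (measurable_pi_apply x.1)
  rw [Measure.map_map hg (measurable_pi_lambda _ hmW),
    Measure.map_map hg (measurable_pi_lambda _ hfW)] at h6
  exact h6

/-- The left-endpoint Riemann sum of `∫_i^{i+1} p^k dp^m` with `n` steps along a path `p`. -/
noncomputable def riemannSum {ι : Type*} (k m : ι) (i n : ℕ) (p : ι × ℝ≥0 → ℝ) : ℝ :=
  ∑ j ∈ Finset.range n, p (k, gridPoint i 1 n j) *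
    (p (m, gridPoint i 1 n (j + 1)) - p (m, gridPoint i 1 n j))

lemma measurable_riemannSum {ι : Type*} (k m : ι) (i n : ℕ) : Measurable (riemannSum k m i n) := by
  unfold riemannSum; fun_prop

lemma riemannSum_scalePath {ι : Type*} {W : ι → ℝ≥0 → Ω → ℝ} (k m : ι)
    (hk : IsScalarBrownianMotion 𝓕 P (W k)) (i κ n : ℕ) [NeZero n] {a b : ℝ≥0}
    (ha : a = κ * i) (hb : b = a + κ) (ω : Ω) :
    riemannSum k m i n (scalePath κ (path W ω)) =
      (κ : ℝ)⁻¹ * (riemannProcess hk a κ hb n).integral (W m) ω := by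
  have e : ∀ j, gridPoint a κ n j = κ * gridPoint i 1 n j := fun j => by
    simp only [gridPoint, ha]; ring
  have e2 : (√(κ : ℝ))⁻¹ * (√(κ : ℝ))⁻¹ = (κ : ℝ)⁻¹ := by
    rw [← mul_inv, Real.mul_self_sqrt (Nat.cast_nonneg κ)]
  have e3 : (riemannProcess hk a κ hb n).integral (W m) ω = ∑ j ∈ Finset.range n,
      W k (gridPoint a κ n j) ω * (W m (gridPoint a κ n (j + 1)) ω - W m (gridPoint a κ n j) ω) :=
    rfl
  rw [e3, riemannSum, Finset.mul_sum]
  refine Finset.sum_congr rfl fun j _ => ?_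
  simp only [e, scalePath, path, ← e2]
  ring

/-- The Riemann sums converge in `L²` of the law of Brownian motion. -/
lemma IsBrownianMotion.exists_tendsto_riemannSum {ι : Type*} [IsProbabilityMeasure P]
    {W : ι → ℝ≥0 → Ω → ℝ} (h : IsBrownianMotion 𝓕 P W) (k m : ι) (i : ℕ) :
    ∃ Φ : (ι × ℝ≥0 → ℝ) → ℝ, Measurable Φ ∧ MemLp Φ 2 (P.map (path W)) ∧
      Tendsto (fun N : ℕ => eLpNorm (riemannSum k m i (4 ^ N) - Φ) 2 (P.map (path W)))
        atTop (𝓝 0) := by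
  have hk := h.component k
  have hm := h.component m
  let S := fun N : ℕ => riemannProcess hk (i : ℝ≥0) 1 rfl (4 ^ N)
  have hR : ∀ N ω, riemannSum k m i (4 ^ N) (path W ω) = (S N).integral (W m) ω := fun N ω => rfl
  have hmp : MeasurePreserving (path W) P (P.map (path W)) := h.measurable_path.measurePreserving P
  have hmeas := fun N : ℕ => measurable_riemannSum (ι := ι) k m i (4 ^ N)
  have hL : ∀ N : ℕ, MemLp (riemannSum k m i (4 ^ N)) 2 (P.map (path W)) := fun N =>
    (memLp_map_measure_iff (hmeas N).aestronglyMeasurable h.measurable_path.aemeasurable).2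
      ((S N).memLp_integral hm)
  have hd : ∀ N M : ℕ, N ≤ M → (S M).sqDist (W k) ≤ (((1 / 4) ^ N : ℝ≥0) : ℝ≥0∞) := by
    intro N M hNM
    refine (sqDist_riemannProcess_le hk _ _ _ _).trans (ENNReal.coe_le_coe.2 ?_)
    push_cast
    rw [mul_one, ← one_div_pow]
    exact pow_le_pow_of_le_one zero_le (by rw [div_le_one] <;> norm_num) hNM
  obtain ⟨f, hf, hft⟩ := Lp.cauchy_complete_eLpNorm one_le_two hL
    (B := fun N => ((3 * (1 / 2) ^ N : ℝ≥0) : ℝ≥0∞)) (by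
      rw [ENNReal.tsum_coe_ne_top_iff_summable]
      exact (NNReal.summable_geometric (by rw [div_lt_one] <;> norm_num)).mul_left 3) (by
      intro N n n' hn hn'
      rw [← eLpNorm_comp_measurePreserving
        ((hmeas n).sub (hmeas n')).aestronglyMeasurable hmp]
      refine lt_of_not_ge fun hc => absurd (pow_le_pow_left' hc 2) (not_le.2 ?_)
      refine ((S n).eLpNorm_integral_sub_sq_le (S n') hm hk).trans_lt ?_
      refine (add_le_add (mul_le_mul_right (hd N n hn) 2)
        (mul_le_mul_right (hd N n' hn') 2)).trans_lt ?_
      rw [← ENNReal.coe_pow]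
      have e2 : (2 : ℝ≥0∞) = ((2 : ℝ≥0) : ℝ≥0∞) := rfl
      rw [e2, ← ENNReal.coe_mul, ← ENNReal.coe_add, ENNReal.coe_lt_coe]
      have e4 : (1 / 4 : ℝ≥0) ^ N = ((1 / 2) ^ N) ^ 2 := by
        rw [← pow_mul, mul_comm, pow_mul]; norm_num
      rw [e4, mul_pow, ← add_mul]
      refine mul_lt_mul_of_pos_right (by norm_num) (by positivity))
  refine ⟨hf.1.aemeasurable.mk f, hf.1.aemeasurable.measurable_mk,
    hf.ae_eq hf.1.aemeasurable.ae_eq_mk, hft.congr fun N => ?_⟩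
  refine eLpNorm_congr_ae ?_
  filter_upwards [hf.1.aemeasurable.ae_eq_mk] with x hx
  simp [hx]

/-- The iterated Itô integral over the `i`-th interval is given by one functional `Φ` of the path: for
every scale `κ`, it sends the rescaled path to the rescaled integral. -/
lemma IsBrownianMotion.exists_itoIntegral_functional {ι : Type*} [Fintype ι]
    [IsProbabilityMeasure P]
    {W : ι → ℝ≥0 → Ω → ℝ} (h : IsBrownianMotion 𝓕 P W) (k m : ι) (i : ℕ) :
    ∃ Φ : (ι × ℝ≥0 → ℝ) → ℝ, Measurable Φ ∧ ∀ κ : ℕ, κ ≠ 0 →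
      IsItoIntegral 𝓕 P (W k) (W m) (κ * i) (κ * (i + 1))
        (itoIntegral 𝓕 P (W k) (W m) (κ * i) (κ * (i + 1))) ∧
      (fun ω => 1 / (κ : ℝ) * itoIntegral 𝓕 P (W k) (W m) (κ * i) (κ * (i + 1)) ω) =ᵐ[P]
        fun ω => Φ (scalePath κ (path W ω)) := by
  obtain ⟨Φ, hΦm, hΦ, hΦt⟩ := h.exists_tendsto_riemannSum k m i
  refine ⟨Φ, hΦm, fun κ hκ => ?_⟩
  have hκ' : (κ : ℝ) ≠ 0 := by exact_mod_cast hκ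
  have hk := h.component k
  have hm := h.component m
  have hb : (κ * (i + 1) : ℝ≥0) = κ * i + κ := by ring
  let S := fun N : ℕ => riemannProcess hk (κ * i) κ hb (4 ^ N)
  have hmp : MeasurePreserving (fun ω => scalePath κ (path W ω)) P (P.map (path W)) :=
    ⟨(measurable_scalePath κ).comp h.measurable_path, h.map_scalePath hκ⟩
  have hΦκ : MemLp (fun ω => κ * Φ (scalePath κ (path W ω))) 2 P :=
    (hΦ.comp_measurePreserving hmp).const_mul (κ : ℝ)
  have ht : Tendsto (fun N => eLpNorm (fun ω => (S N).integral (W m) ω -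
      κ * Φ (scalePath κ (path W ω))) 2 P) atTop (𝓝 0) := by
    have := ENNReal.Tendsto.const_mul hΦt (a := ‖(κ : ℝ)‖ₑ) (by simp)
    rw [mul_zero] at this
    refine this.congr fun N => ?_
    rw [← eLpNorm_comp_measurePreserving
      ((measurable_riemannSum k m i (4 ^ N)).sub hΦm).aestronglyMeasurable hmp,
      ← eLpNorm_const_smul]
    congr 1
    ext ω
    simp only [Pi.smul_apply, Function.comp, Pi.sub_apply, smul_eq_mul]
    rw [riemannSum_scalePath k m hk i κ (4 ^ N) rfl hb ω, mul_sub, mul_inv_cancel_left₀ hκ']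
  have hex : ∃ J, IsItoIntegral 𝓕 P (W k) (W m) (κ * i) (κ * (i + 1)) J :=
    ⟨_, hΦκ, S, tendsto_sqDist_riemannProcess hk _ _ hb, ht⟩
  have hJ : IsItoIntegral 𝓕 P (W k) (W m) (κ * i) (κ * (i + 1))
      (itoIntegral 𝓕 P (W k) (W m) (κ * i) (κ * (i + 1))) := by
    rw [itoIntegral, dif_pos hex]
    exact hex.choose_spec
  refine ⟨hJ, ?_⟩
  have ht' := hJ.tendsto_eLpNorm hm hk (tendsto_sqDist_riemannProcess hk _ _ hb)
  have hmS := fun N => ((S N).memLp_integral hm).1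
  have := tendstoInMeasure_ae_unique (tendstoInMeasure_of_tendsto_eLpNorm two_ne_zero hmS hJ.1.1 ht')
    (tendstoInMeasure_of_tendsto_eLpNorm two_ne_zero hmS hΦκ.1 ht)
  filter_upwards [this] with ω hω
  rw [hω]
  field_simp

end

/-! ### Linear algebra of the coefficients, and variables with all moments -/

section

lemma gammaCoef_mul_eq_zero_of_rank_lt {d q r : ℕ} {A : Matrix (Fin d) (Fin q) ℝ}
    (hA : A.rank < r) (X : Matrix (Fin q) (Fin d) ℝ) (Y : Matrix (Fin d) (Fin d) ℝ) :
    gammaCoef r (A * X) Y = 0 := by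
  refine Finset.sum_eq_zero fun I hI => ?_
  by_contra hne
  have hI' : I.card = r := (Finset.mem_powersetCard.1 hI).2
  have hu := (Matrix.isUnit_iff_isUnit_det _).2 (isUnit_iff_ne_zero.2 hne)
  have hli := Matrix.linearIndependent_cols_iff_isUnit.2 hu
  have hli' := hli.comp (fun j : I => (j : Fin d)) Subtype.val_injective
  have e : (Matrix.col (Matrix.of fun i j => if j ∈ I then (A * X) i j else Y i j)) ∘
      (fun j : I => (j : Fin d)) = fun j : I => (A * X).col j := by
    ext j i
    exact if_pos j.2
  rw [e] at hli'
  have h1 := finrank_span_eq_card hli'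
  have h2 : Module.finrank ℝ (Submodule.span ℝ (Set.range fun j : I => (A * X).col j)) ≤
      (A * X).rank := by
    rw [Matrix.rank_eq_finrank_span_cols]
    exact Submodule.finrank_mono (Submodule.span_mono (by rintro _ ⟨j, rfl⟩; exact ⟨j, rfl⟩))
  have h3 := Matrix.rank_mul_le_left A X
  rw [h1, Fintype.card_coe] at h2
  omega

lemma gammaCoef_self {d : ℕ} (X Y : Matrix (Fin d) (Fin d) ℝ) : gammaCoef d X Y = X.det := by
  have : (Finset.univ : Finset (Fin d)).powersetCard d = {Finset.univ} := by
    have h := Finset.powersetCard_self (Finset.univ : Finset (Fin d))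
    rwa [Finset.card_fin] at h
  rw [gammaCoef, this, Finset.sum_singleton]
  congr 1
  ext i j
  simp

/-- The matrix with the first `r` columns of `X` and the other columns of `Y`. -/
def mixCols {d : ℕ} (r : ℕ) (X Y : Matrix (Fin d) (Fin d) ℝ) : Matrix (Fin d) (Fin d) ℝ :=
  Matrix.of fun i j => if (j : ℕ) < r then X i j else Y i j

lemma exists_det_mixCols_ne_zero {d q r : ℕ} (hr : r ≤ d) {A : Matrix (Fin d) (Fin q) ℝ}
    (hA : A.rank = r) : ∃ (X : Matrix (Fin q) (Fin d) ℝ) (Y : Matrix (Fin d) (Fin d) ℝ),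
      (mixCols r (A * X) Y).det ≠ 0 := by
  obtain ⟨k, rfl⟩ := Nat.exists_eq_add_of_le hr
  set V := LinearMap.range A.mulVecLin with hV
  obtain ⟨C, hC⟩ := V.exists_isCompl
  have hVr : Module.finrank ℝ V = r := hA
  have hCk : Module.finrank ℝ C = k := by
    have := Submodule.finrank_add_eq_of_isCompl hC
    rw [hVr, Module.finrank_fin_fun] at this
    omega
  let b₁ := Module.finBasisOfFinrankEq ℝ V hVr
  let b₂ := Module.finBasisOfFinrankEq ℝ C hCk
  let b := ((b₁.prod b₂).map (Submodule.prodEquivOfIsCompl V C hC)).reindex finSumFinEquiv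
  have hb₁ : ∀ j : Fin r, b (Fin.castAdd k j) = b₁ j := fun j => by
    simp [b]
  choose x hx using fun j : Fin r => (b₁ j).2
  refine ⟨Matrix.of fun i j => if h : (j : ℕ) < r then x ⟨j, h⟩ i else 0,
    Matrix.of fun i j => b j i, ?_⟩
  have hli : LinearIndependent ℝ (Matrix.col (Matrix.of fun i j => b j i)) := b.linearIndependent
  have hu := (Matrix.isUnit_iff_isUnit_det _).1 (Matrix.linearIndependent_cols_iff_isUnit.1 hli)
  have e : mixCols r (A * Matrix.of fun i (j : Fin (r + k)) =>
      if h : (j : ℕ) < r then x ⟨j, h⟩ i else 0) (Matrix.of fun i j => b j i) =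
      Matrix.of fun i j => b j i := by
    ext i j
    simp only [mixCols, Matrix.of_apply]
    split_ifs with h
    · have h1 : b j = b₁ ⟨j, h⟩ := hb₁ ⟨j, h⟩
      rw [h1, ← hx ⟨j, h⟩, Matrix.mulVecLin_apply, Matrix.mul_apply, Matrix.mulVec, dotProduct]
      refine Finset.sum_congr rfl fun m _ => ?_
      simp [h]
    · rfl
  rw [e]
  exact isUnit_iff_ne_zero.1 hu

/-- Killing the first `r` columns of `Y` leaves a single determinant in `gammaCoef`, which is
homogeneous in each of the other columns of `Y`. -/
lemma gammaCoef_eq_mul_det_mixCols {d r : ℕ} (X Y : Matrix (Fin d) (Fin d) ℝ) (l : Fin d)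
    (hl : r ≤ l) (c : ℝ) :
    gammaCoef r X (Matrix.of fun i j =>
      if (j : ℕ) < r then 0 else if j = l then c * Y i j else Y i j) =
      c * (mixCols r X Y).det := by
  set I₀ : Finset (Fin d) := Finset.univ.filter fun j => (j : ℕ) < r with hI₀
  have hcard : I₀.card = r := by
    rw [hI₀, Fin.card_filter_val_lt]
    have := l.2
    omega
  rw [gammaCoef, Finset.sum_eq_single I₀]
  · have := Matrix.det_updateCol_smul (mixCols r X Y) l c ((mixCols r X Y).col l)
    have e : (mixCols r X Y).updateCol l ((mixCols r X Y).col l) = mixCols r X Y :=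
      Matrix.updateCol_eq_self _ _
    rw [e] at this
    rw [← this]
    congr 1
    ext i j
    rw [Matrix.updateCol_apply]
    by_cases hj : j = l
    · subst hj
      simp [mixCols, hI₀, Nat.not_lt.2 hl]
    · simp only [hj, if_false, mixCols, Matrix.of_apply, hI₀, Finset.mem_filter, Finset.mem_univ,
        true_and]
      split_ifs <;> rfl
  · intro I hI hne
    have hI' : I.card = r := (Finset.mem_powersetCard.1 hI).2
    have : ∃ j ∈ I₀, j ∉ I := by
      by_contra! hsub
      exact hne (Finset.eq_of_subset_of_card_le hsub (by omega)).symm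
    obtain ⟨j, hj, hjI⟩ := this
    refine Matrix.det_eq_zero_of_column_eq_zero j fun i => ?_
    have : (j : ℕ) < r := (Finset.mem_filter.1 hj).2
    simp [hjI, this]
  · intro h
    exact absurd (Finset.mem_powersetCard.2 ⟨Finset.subset_univ _, hcard⟩) h

lemma continuous_gammaCoef {E : Type*} [TopologicalSpace E] {d r : ℕ}
    {X Y : E → Matrix (Fin d) (Fin d) ℝ} (hX : Continuous X) (hY : Continuous Y) :
    Continuous fun e => gammaCoef r (X e) (Y e) := by
  refine continuous_finsetSum _ fun I _ => Continuous.matrix_det ?_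
  refine continuous_matrix fun i j => ?_
  simp only [Matrix.of_apply]
  split_ifs
  · exact hX.matrix_elem i j
  · exact hY.matrix_elem i j

lemma measurable_gammaCoef {E : Type*} [MeasurableSpace E] {d r : ℕ}
    {X Y : E → Matrix (Fin d) (Fin d) ℝ} (hX : ∀ i j, Measurable fun e => X e i j)
    (hY : ∀ i j, Measurable fun e => Y e i j) :
    Measurable fun e => gammaCoef r (X e) (Y e) := by
  unfold gammaCoef
  refine Finset.measurable_fun_sum _ fun I _ => ?_
  simp only [Matrix.det_apply']
  refine Finset.measurable_fun_sum _ fun σ _ => Measurable.const_mul ?_ _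
  refine Finset.measurable_fun_prod _ fun i _ => ?_
  simp only [Matrix.of_apply]
  split_ifs
  · exact hX _ _
  · exact hY _ _

/-- All absolute moments of `f` are finite. -/
def HasAllMoments {Ω : Type*} [MeasurableSpace Ω] (f : Ω → ℝ) (P : Measure Ω) : Prop :=
  ∀ p : ℝ≥0, MemLp f p P

namespace HasAllMoments

variable {Ω : Type*} [MeasurableSpace Ω] {f g : Ω → ℝ} {P : Measure Ω}

lemma const [IsProbabilityMeasure P] (c : ℝ) : HasAllMoments (fun _ : Ω => c) P :=
  fun _ => memLp_const c

lemma add (hf : HasAllMoments f P) (hg : HasAllMoments g P) :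
    HasAllMoments (fun ω => f ω + g ω) P := fun p => (hf p).add (hg p)

lemma const_mul (hf : HasAllMoments f P) (c : ℝ) : HasAllMoments (fun ω => c * f ω) P :=
  fun p => (hf p).const_mul c

lemma sum {ι : Type*} (s : Finset ι) {f : ι → Ω → ℝ} (hf : ∀ i ∈ s, HasAllMoments (f i) P) :
    HasAllMoments (fun ω => ∑ i ∈ s, f i ω) P :=
  fun p => memLp_finsetSum _ fun i hi => hf i hi p

lemma mul (hf : HasAllMoments f P) (hg : HasAllMoments g P) :
    HasAllMoments (fun ω => f ω * g ω) P := fun p => by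
  have : ENNReal.HolderTriple ((2 * p : ℝ≥0) : ℝ≥0∞) ((2 * p : ℝ≥0) : ℝ≥0∞) p := by
    constructor
    rw [ENNReal.coe_mul, ENNReal.mul_inv (by simp) (by simp), ← add_mul]
    have : ((2 : ℝ≥0) : ℝ≥0∞)⁻¹ + ((2 : ℝ≥0) : ℝ≥0∞)⁻¹ = 1 := ENNReal.inv_two_add_inv_two
    rw [this, one_mul]
  exact (hg (2 * p)).mul (hf (2 * p))

lemma prod [IsProbabilityMeasure P] {ι : Type*} (s : Finset ι) {f : ι → Ω → ℝ}
    (hf : ∀ i ∈ s, HasAllMoments (f i) P) : HasAllMoments (fun ω => ∏ i ∈ s, f i ω) P := by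
  classical
  induction s using Finset.induction_on with
  | empty => simpa using const 1
  | insert i s hi ih =>
    simp only [Finset.prod_insert hi]
    exact (hf i (by simp)).mul (ih fun j hj => hf j (by simp [hj]))

lemma gammaCoef [IsProbabilityMeasure P] {d r : ℕ} {X Y : Ω → Matrix (Fin d) (Fin d) ℝ}
    (hX : ∀ i j, HasAllMoments (fun ω => X ω i j) P)
    (hY : ∀ i j, HasAllMoments (fun ω => Y ω i j) P) :
    HasAllMoments (fun ω => gammaCoef r (X ω) (Y ω)) P := by
  unfold RankTest.gammaCoef
  refine sum _ fun I _ => ?_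
  simp only [Matrix.det_apply']
  refine sum _ fun σ _ => const_mul (prod _ fun i _ => ?_) _
  simp only [Matrix.of_apply]
  split_ifs
  · exact hX _ _
  · exact hY _ _

end HasAllMoments

end

/-! ### The variables as functionals of the rescaled paths -/

section

variable {Ω : Type*} [mΩ : MeasurableSpace Ω] {𝓕 : Filtration ℝ≥0 mΩ} {P : Measure Ω}

/-- The increments of a path over the unit intervals `[j, j + 1]`, `j < n`. -/
def increments {ι : Type*} (n : ℕ) (p : ι × ℝ≥0 → ℝ) (m : ι) (j : Fin n) : ℝ :=
  p (m, (j : ℕ) + 1) - p (m, (j : ℕ))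

lemma measurable_increments {ι : Type*} (n : ℕ) : Measurable (increments (ι := ι) n) := by
  unfold increments; fun_prop

/-- The increments of a Brownian motion over unit intervals are independent and standard normal,
so that their joint law charges every open set. -/
lemma IsBrownianMotion.isOpenPosMeasure_map_increments {ι : Type*} [Fintype ι]
    [IsProbabilityMeasure P] {W : ι → ℝ≥0 → Ω → ℝ} (h : IsBrownianMotion 𝓕 P W) (n : ℕ) :
    (P.map fun ω => increments n (path W ω)).IsOpenPosMeasure := by
  have hmW : ∀ m, Measurable fun ω (t : ℝ≥0) => W m t ω := fun m =>
    measurable_pi_lambda _ fun t => (h.component m).measurable t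
  let f : (ℝ≥0 → ℝ) → Fin n → ℝ := fun g j => g ((j : ℕ) + 1) - g (j : ℕ)
  have hf : Measurable f := by fun_prop
  have h2 := h.iIndepFun_components.comp (fun _ => f) fun _ => hf
  have h3 := (iIndepFun_iff_map_fun_eq_pi_map fun m => (hf.comp (hmW m)).aemeasurable).1 h2
  have h4 : ∀ m, P.map (f ∘ fun ω t => W m t ω) = Measure.pi fun _ => gaussianReal 0 1 := by
    intro m
    have hm := h.component m
    have hmono : Monotone fun j : ℕ => (j : ℝ≥0) := Nat.mono_cast
    have h5 := (hm.isBrownianReal.hasIndepIncrements.nat hmono).precomp (g := fun j : Fin n => (j : ℕ))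
      Fin.val_injective
    have h6 : ∀ j : Fin n, Measurable fun ω => W m (((j : ℕ) + 1 : ℕ) : ℝ≥0) ω - W m (j : ℕ) ω :=
      fun j => (hm.measurable _).sub (hm.measurable _)
    have h7 := (iIndepFun_iff_map_fun_eq_pi_map fun j => (h6 j).aemeasurable).1 h5
    have h8 : ∀ j : Fin n, P.map (fun ω => W m (((j : ℕ) + 1 : ℕ) : ℝ≥0) ω - W m (j : ℕ) ω) =
        gaussianReal 0 1 := fun j => by
      rw [(hm.hasLaw_increment (hmono (Nat.le_succ _))).map_eq]
      congr 1
      push_cast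
      exact add_tsub_cancel_left _ _
    simp only [h8] at h7
    rw [← h7]
    congr 1
    ext ω j
    simp [f]
  have h9 : P.map (fun ω => increments n (path W ω)) =
      Measure.pi fun _ : ι => Measure.pi fun _ : Fin n => gaussianReal 0 1 := by
    refine Eq.trans h3 ?_
    simp only [h4]
  have : (gaussianReal 0 1).IsOpenPosMeasure :=
    (gaussianReal_absolutelyContinuous' 0 one_ne_zero).isOpenPosMeasure
  have hn : (Measure.pi fun _ : Fin n => gaussianReal 0 1).IsOpenPosMeasure :=
    Measure.pi.isOpenPosMeasure _
  rw [h9]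
  exact Measure.pi.isOpenPosMeasure _

/-- A continuous equation that holds for the increments of almost every Brownian path is an
identity. -/
lemma IsBrownianMotion.eq_of_ae_increments {ι : Type*} [Fintype ι] [IsProbabilityMeasure P]
    {W : ι → ℝ≥0 → Ω → ℝ} (h : IsBrownianMotion 𝓕 P W) {n : ℕ} {f g : (ι → Fin n → ℝ) → ℝ}
    (hf : Continuous f) (hg : Continuous g)
    (hfg : ∀ᵐ p ∂P.map (path W), f (increments n p) = g (increments n p)) : f = g := by
  have := h.isOpenPosMeasure_map_increments n
  have hm : Measurable fun ω => increments n (path W ω) :=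
    (measurable_increments n).comp h.measurable_path
  have h1 : ∀ᵐ x ∂P.map fun ω => increments n (path W ω), f x = g x := by
    have h2 := ae_of_ae_map h.measurable_path.aemeasurable hfg
    rw [ae_map_iff hm.aemeasurable (measurableSet_eq_fun hf.measurable hg.measurable)]
    exact h2
  exact (Continuous.ae_eq_iff_eq _ hf hg).1 h1

/-- The increments of the path scaled by two, in terms of those of the path. -/
noncomputable def coarse {ι : Type*} {d : ℕ} (x : ι → Fin (2 * d) → ℝ) (m : ι) (j : Fin d) : ℝ :=
  (√2)⁻¹ * (x m ⟨2 * j, by omega⟩ + x m ⟨2 * j + 1, by omega⟩)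

/-- The first half of the increments. -/
def firstHalf {ι : Type*} {d : ℕ} (x : ι → Fin (2 * d) → ℝ) (m : ι) (j : Fin d) : ℝ :=
  x m ⟨j, by omega⟩

/-- A right inverse of `coarse`, in which the increments of even index vanish. -/
noncomputable def spread {ι : Type*} {d : ℕ} (x : Matrix ι (Fin d) ℝ) (m : ι) (j : Fin (2 * d)) : ℝ :=
  if (j : ℕ) % 2 = 0 then 0 else √2 * x m ⟨j / 2, by omega⟩

lemma of_coarse_spread {ι : Type*} {d : ℕ} (x : Matrix ι (Fin d) ℝ) :
    Matrix.of (coarse (spread x)) = x := by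
  ext m j
  have h1 : (2 * (j : ℕ) + 1) % 2 = 1 := by omega
  have h2 : (2 * (j : ℕ) + 1) / 2 = j := by omega
  simp [coarse, spread, h1, h2]

/-- `spread` puts the last column of its argument beyond the first half. -/
lemma firstHalf_spread_congr {ι : Type*} {d : ℕ} {x y : Matrix ι (Fin d) ℝ}
    (h : ∀ m (j : Fin d), (j : ℕ) + 1 < d → x m j = y m j) :
    firstHalf (spread x) = firstHalf (spread y) := by
  ext m j
  simp only [firstHalf, spread]
  split_ifs with h0
  · rfl
  · rw [h m ⟨j / 2, by omega⟩ (by have := j.2; simp only; omega)]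

lemma continuous_coarse {ι : Type*} {d : ℕ} : Continuous (coarse (ι := ι) (d := d)) := by
  unfold coarse; fun_prop

lemma continuous_firstHalf {ι : Type*} {d : ℕ} : Continuous (firstHalf (ι := ι) (d := d)) := by
  unfold firstHalf; fun_prop

lemma increments_scalePath_one {ι : Type*} {d : ℕ} (p : ι × ℝ≥0 → ℝ) :
    increments d (scalePath 1 p) = firstHalf (increments (2 * d) p) := by
  ext m j
  simp [increments, scalePath, firstHalf]

lemma increments_scalePath_two {ι : Type*} {d : ℕ} (p : ι × ℝ≥0 → ℝ) :
    increments d (scalePath 2 p) = coarse (increments (2 * d) p) := by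
  ext m j
  have e : (2 * ((j : ℕ) + 1) : ℝ≥0) = 2 * (j : ℕ) + 1 + 1 := by ring
  simp only [increments, scalePath, coarse]
  push_cast
  rw [e]
  ring

section Functional

variable {d q : ℕ} (u : Param d q)

/-- The part of the second components of `Ψ(u, κ)` that is determined by the path `p` of `W`, where
`Φ i k m` gives the iterated integrals. -/
def drift (Φ : Fin d → Fin q → Fin q → (Fin q × ℝ≥0 → ℝ) → ℝ) (p : Fin q × ℝ≥0 → ℝ) :
    Matrix (Fin d) (Fin d) ℝ :=
  Matrix.of fun l j => u.a l + ∑ m, ∑ k, u.γ l m k * Φ j k m p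

/-- The variable `F_r(u, κ)` as a function of the rescaled paths of `W` and `W'`. -/
def pathFunctional (r : ℕ) (Φ : Fin d → Fin q → Fin q → (Fin q × ℝ≥0 → ℝ) → ℝ)
    (p : Fin q × ℝ≥0 → ℝ) (p' : Fin d × ℝ≥0 → ℝ) : ℝ :=
  gammaCoef r (u.α * Matrix.of (increments d p)) (drift u Φ p + u.β * Matrix.of (increments d p')) ^ 2

variable {u}

lemma measurable_pathFunctional (r : ℕ) {Φ : Fin d → Fin q → Fin q → (Fin q × ℝ≥0 → ℝ) → ℝ}
    (hΦ : ∀ j k m, Measurable (Φ j k m)) {E : Type*} [MeasurableSpace E]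
    {p : E → Fin q × ℝ≥0 → ℝ} {p' : E → Fin d × ℝ≥0 → ℝ} (hp : Measurable p)
    (hp' : Measurable p') : Measurable fun e => pathFunctional u r Φ (p e) (p' e) := by
  have h1 : ∀ m j, Measurable fun e => increments d (p e) m j := fun m j =>
    ((measurable_pi_apply _).comp hp).sub ((measurable_pi_apply _).comp hp)
  have h2 : ∀ m j, Measurable fun e => increments d (p' e) m j := fun m j =>
    ((measurable_pi_apply _).comp hp').sub ((measurable_pi_apply _).comp hp')
  have h3 : ∀ j k m, Measurable fun e => Φ j k m (p e) := fun j k m => (hΦ j k m).comp hp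
  refine (measurable_gammaCoef (fun i j => ?_) fun i j => ?_).pow_const 2
  · simp only [Matrix.mul_apply, Matrix.of_apply]
    fun_prop
  · simp only [Matrix.add_apply, Matrix.mul_apply, Matrix.of_apply, drift]
    fun_prop

lemma FVar_eq_gammaCoef (W : Fin q → ℝ≥0 → Ω → ℝ) (W' : Fin d → ℝ≥0 → Ω → ℝ) (r κ : ℕ) (ω : Ω) :
    FVar 𝓕 P W W' u r κ ω =
      gammaCoef r (u.α * Matrix.of (increments d (scalePath κ (path W ω))))
        (Matrix.of (fun l (j : Fin d) => u.a l + ∑ m, ∑ k, u.γ l m k * (1 / (κ : ℝ) *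
          itoIntegral 𝓕 P (W k) (W m) (κ * (j : ℕ)) (κ * ((j : ℕ) + 1)) ω)) +
        u.β * Matrix.of (increments d (scalePath κ (path W' ω)))) ^ 2 := by
  rw [FVar, detFun]
  congr 2
  · ext l j
    simp only [Matrix.of_apply, Psi, Matrix.mul_apply, increments, scalePath, path, Finset.mul_sum]
    refine Finset.sum_congr rfl fun m _ => ?_
    ring
  · ext l j
    simp only [Matrix.of_apply, Psi, Matrix.mul_apply, increments, scalePath, path, Finset.mul_sum,
      Matrix.add_apply]
    rw [add_right_comm]
    congr 1
    · congr 1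
      refine Finset.sum_congr rfl fun m _ => Finset.sum_congr rfl fun k _ => ?_
      ring
    · refine Finset.sum_congr rfl fun m _ => ?_
      ring

variable [IsProbabilityMeasure P] {W : Fin q → ℝ≥0 → Ω → ℝ} {W' : Fin d → ℝ≥0 → Ω → ℝ}

lemma exists_FVar_eq_pathFunctional (hW : IsBrownianMotion 𝓕 P W) (u : Param d q) (r : ℕ) :
    ∃ Φ : Fin d → Fin q → Fin q → (Fin q × ℝ≥0 → ℝ) → ℝ, (∀ j k m, Measurable (Φ j k m)) ∧
      ∀ κ : ℕ, κ ≠ 0 → FVar 𝓕 P W W' u r κ =ᵐ[P]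
        fun ω => pathFunctional u r Φ (scalePath κ (path W ω)) (scalePath κ (path W' ω)) := by
  choose Φ hΦm hΦ using fun (j : Fin d) k m => hW.exists_itoIntegral_functional k m (j : ℕ)
  refine ⟨Φ, hΦm, fun κ hκ => ?_⟩
  have h1 : ∀ᵐ ω ∂P, ∀ (j : Fin d) k m, 1 / (κ : ℝ) *
      itoIntegral 𝓕 P (W k) (W m) (κ * (j : ℕ)) (κ * ((j : ℕ) + 1)) ω =
        Φ j k m (scalePath κ (path W ω)) :=
    ae_all_iff.2 fun j => ae_all_iff.2 fun k => ae_all_iff.2 fun m => (hΦ j k m κ hκ).2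
  filter_upwards [h1] with ω hω
  rw [FVar_eq_gammaCoef]
  simp only [hω]
  rfl

lemma memLp_FVar (hW : IsBrownianMotion 𝓕 P W) (hW' : IsBrownianMotion 𝓕 P W') (u : Param d q)
    (r : ℕ) {κ : ℕ} (hκ : κ ≠ 0) : MemLp (FVar 𝓕 P W W' u r κ) 2 P := by
  have hinc : ∀ {ι : Type} {V : ι → ℝ≥0 → Ω → ℝ}, IsBrownianMotion 𝓕 P V → ∀ m (j : Fin d),
      HasAllMoments (fun ω => increments d (scalePath κ (path V ω)) m j) P := fun hV m j p =>
    (((hV.component m).memLp_eval _ p).const_mul _).sub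
      (((hV.component m).memLp_eval _ p).const_mul _)
  have hito : ∀ k m (j : Fin d), HasAllMoments
      (itoIntegral 𝓕 P (W k) (W m) (κ * (j : ℕ)) (κ * ((j : ℕ) + 1))) P := fun k m j p => by
    obtain ⟨Φ, -, hΦ⟩ := hW.exists_itoIntegral_functional k m (j : ℕ)
    exact (hΦ κ hκ).1.memLp (hW.component m) (hW.component k) (by gcongr; simp) p
  have hg : HasAllMoments (fun ω =>
      gammaCoef r (u.α * Matrix.of (increments d (scalePath κ (path W ω))))
        (Matrix.of (fun l (j : Fin d) => u.a l + ∑ m, ∑ k, u.γ l m k * (1 / (κ : ℝ) *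
          itoIntegral 𝓕 P (W k) (W m) (κ * (j : ℕ)) (κ * ((j : ℕ) + 1)) ω)) +
        u.β * Matrix.of (increments d (scalePath κ (path W' ω))))) P := by
    refine HasAllMoments.gammaCoef (fun l j => ?_) fun l j => ?_
    · simp only [Matrix.mul_apply, Matrix.of_apply]
      exact HasAllMoments.sum _ fun m _ => (hinc hW m j).const_mul _
    · simp only [Matrix.add_apply, Matrix.mul_apply, Matrix.of_apply]
      refine ((HasAllMoments.const _).add (HasAllMoments.sum _ fun m _ =>
        HasAllMoments.sum _ fun k _ => ((hito k m j).const_mul _).const_mul _)).add ?_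
      exact HasAllMoments.sum _ fun m _ => (hinc hW' m j).const_mul _
  refine ((hg.mul hg) 2).ae_eq (ae_of_all _ fun ω => ?_)
  rw [FVar_eq_gammaCoef, pow_two]

lemma map_scalePath_prod (hW : IsBrownianMotion 𝓕 P W) (hW' : IsBrownianMotion 𝓕 P W')
    (hWW' : IndepFun (path W) (path W') P) {κ : ℕ} (hκ : κ ≠ 0) :
    P.map (fun ω => (scalePath κ (path W ω), scalePath κ (path W' ω))) =
      (P.map (path W)).prod (P.map (path W')) := by
  have h := hWW'.comp (measurable_scalePath κ) (measurable_scalePath κ)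
  rw [indepFun_iff_map_prod_eq_prod_map_map
    ((measurable_scalePath κ).comp hW.measurable_path).aemeasurable
    ((measurable_scalePath κ).comp hW'.measurable_path).aemeasurable] at h
  refine h.trans ?_
  congr 1
  · exact hW.map_scalePath hκ
  · exact hW'.map_scalePath hκ

lemma integral_FVar_pow_eq (hW : IsBrownianMotion 𝓕 P W) (hW' : IsBrownianMotion 𝓕 P W')
    (hWW' : IndepFun (path W) (path W') P) (u : Param d q) (r n : ℕ) {κ κ' : ℕ} (hκ : κ ≠ 0)
    (hκ' : κ' ≠ 0) :
    ∫ ω, FVar 𝓕 P W W' u r κ ω ^ n ∂P = ∫ ω, FVar 𝓕 P W W' u r κ' ω ^ n ∂P := by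
  obtain ⟨Φ, hΦ, hF⟩ := exists_FVar_eq_pathFunctional (W' := W') hW u r
  have key : ∀ κ : ℕ, κ ≠ 0 → ∫ ω, FVar 𝓕 P W W' u r κ ω ^ n ∂P =
      ∫ x, pathFunctional u r Φ x.1 x.2 ^ n ∂((P.map (path W)).prod (P.map (path W'))) := by
    intro κ hκ
    rw [← map_scalePath_prod hW hW' hWW' hκ, integral_map]
    · refine integral_congr_ae ?_
      filter_upwards [hF κ hκ] with ω hω
      rw [hω]
    · exact (((measurable_scalePath κ).comp hW.measurable_path).prodMk
        ((measurable_scalePath κ).comp hW'.measurable_path)).aemeasurable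
    · exact ((measurable_pathFunctional r hΦ measurable_fst measurable_snd).pow_const n).aestronglyMeasurable
  rw [key κ hκ, key κ' hκ']

end Functional

end

/-! ### Nondegeneracy -/

section

variable {Ω : Type*} [mΩ : MeasurableSpace Ω] {𝓕 : Filtration ℝ≥0 mΩ} {P : Measure Ω}
  {d q : ℕ} [IsProbabilityMeasure P] {W : Fin q → ℝ≥0 → Ω → ℝ} {W' : Fin d → ℝ≥0 → Ω → ℝ}
  {u : Param d q}

/-- Fubini's theorem for an almost sure identity between functions of independent variables. -/
lemma ae_ae_eq_of_indepFun {α β : Type*} [MeasurableSpace α] [MeasurableSpace β] {X : Ω → α}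
    {Y : Ω → β} (hX : Measurable X) (hY : Measurable Y) (h : IndepFun X Y P) {f g : α × β → ℝ}
    (hf : Measurable f) (hg : Measurable g) (hfg : ∀ᵐ ω ∂P, f (X ω, Y ω) = g (X ω, Y ω)) :
    ∀ᵐ x ∂P.map X, ∀ᵐ y ∂P.map Y, f (x, y) = g (x, y) := by
  refine Measure.ae_ae_of_ae_prod (μ := P.map X) (ν := P.map Y) (p := fun z => f z = g z) ?_
  rw [← (indepFun_iff_map_prod_eq_prod_map_map hX.aemeasurable hY.aemeasurable).1 h]
  exact (ae_map_iff (hX.prodMk hY).aemeasurable (measurableSet_eq_fun hf hg)).2 hfg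

/-- For `r < d`, freezing a path of `W` that is nondegenerate at the coarse scale, the last coarse
increment of `W'` changes the right-hand side of the identity but not the left-hand side. -/
lemma not_ae_ae_pathFunctional_eq_of_rank_lt (hW : IsBrownianMotion 𝓕 P W)
    (hW' : IsBrownianMotion 𝓕 P W') (hβ : IsUnit u.β) {r : ℕ} (hα : u.α.rank = r) (hrd : r < d)
    (Φ : Fin d → Fin q → Fin q → (Fin q × ℝ≥0 → ℝ) → ℝ) :
    ¬ ∀ᵐ p ∂P.map (path W), ∀ᵐ p' ∂P.map (path W'),
      pathFunctional u r Φ (scalePath 1 p) (scalePath 1 p') =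
        pathFunctional u r Φ (scalePath 2 p) (scalePath 2 p') := by
  intro hpp
  obtain ⟨X₀, Y₀, hdet⟩ := exists_det_mixCols_ne_zero hrd.le hα
  set l : Fin d := ⟨d - 1, by omega⟩ with hl
  have hlast : ∀ j : Fin d, (j : ℕ) + 1 < d → j ≠ l := fun j hj hjl => by
    rw [hjl, hl] at hj
    simp only at hj
    omega
  have hall : ∀ᵐ p ∂P.map (path W), ∀ x : Fin d → Fin (2 * d) → ℝ,
      gammaCoef r (u.α * Matrix.of (increments d (scalePath 1 p)))
          (drift u Φ (scalePath 1 p) + u.β * Matrix.of (firstHalf x)) ^ 2 =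
        gammaCoef r (u.α * Matrix.of (increments d (scalePath 2 p)))
          (drift u Φ (scalePath 2 p) + u.β * Matrix.of (coarse x)) ^ 2 := by
    filter_upwards [hpp] with p hp
    simp only [pathFunctional, increments_scalePath_one (ι := Fin d),
      increments_scalePath_two (ι := Fin d)] at hp
    have hc : ∀ (X D : Matrix (Fin d) (Fin d) ℝ)
        {f : (Fin d → Fin (2 * d) → ℝ) → Fin d → Fin d → ℝ}, Continuous f →
        Continuous fun x => gammaCoef r X (D + u.β * Matrix.of (f x)) ^ 2 := fun X D f hf =>
      (continuous_gammaCoef continuous_const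
        (continuous_const.add (continuous_const.matrix_mul hf))).pow 2
    exact congrFun (hW'.eq_of_ae_increments (hc _ _ continuous_firstHalf)
      (hc _ _ continuous_coarse) hp)
  -- with positive probability the path of `W` is nondegenerate at the coarse scale
  have hgood : ∃ᶠ p in ae (P.map (path W)),
      (mixCols r (u.α * Matrix.of (increments d (scalePath 2 p))) Y₀).det ≠ 0 := by
    intro hae
    have h2 := hW.eq_of_ae_increments (n := 2 * d) (g := fun _ => 0)
      (f := fun x => (mixCols r (u.α * Matrix.of (coarse x)) Y₀).det) ?_ continuous_const (by
        filter_upwards [hae] with p hp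
        rw [not_not, increments_scalePath_two] at hp
        exact hp)
    · have h3 := congrFun h2 (spread X₀)
      rw [of_coarse_spread] at h3
      exact hdet h3
    · refine Continuous.matrix_det (continuous_matrix fun i j => ?_)
      simp only [mixCols, Matrix.of_apply]
      split_ifs
      · exact (continuous_const.matrix_mul continuous_coarse).matrix_elem i j
      · exact continuous_const
  obtain ⟨p, hp, hpx⟩ := (hgood.and_eventually hall).exists
  set X := u.α * Matrix.of (increments d (scalePath 2 p)) with hX
  -- the coarse increments of `W'` are chosen so that the last columns are `Y`
  let Y : ℝ → Matrix (Fin d) (Fin d) ℝ := fun c => Matrix.of fun i j =>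
    if (j : ℕ) < r then 0 else if j = l then c * Y₀ i j else Y₀ i j
  let N : ℝ → Matrix (Fin d) (Fin d) ℝ := fun c => u.β⁻¹ * (Y c - drift u Φ (scalePath 2 p))
  have hN : ∀ c, drift u Φ (scalePath 2 p) + u.β * N c = Y c := fun c => by
    simp only [N]
    rw [Matrix.mul_nonsing_inv_cancel_left _ _ ((Matrix.isUnit_iff_isUnit_det _).1 hβ)]
    abel
  have hval : ∀ c, gammaCoef r (u.α * Matrix.of (increments d (scalePath 1 p)))
      (drift u Φ (scalePath 1 p) + u.β * Matrix.of (firstHalf (spread (N c)))) ^ 2 =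
      (c * (mixCols r X Y₀).det) ^ 2 := fun c => by
    rw [hpx (spread (N c)), of_coarse_spread, hN c, gammaCoef_eq_mul_det_mixCols X Y₀ l]
    rw [hl]
    simp only
    omega
  have hsame : firstHalf (spread (N 1)) = firstHalf (spread (N 2)) := by
    refine firstHalf_spread_congr fun m j hj => ?_
    simp only [N, Matrix.mul_apply, Matrix.sub_apply, Y, Matrix.of_apply, if_neg (hlast j hj)]
  have h12 := hval 1
  rw [hsame, hval 2] at h12
  have : (mixCols r X Y₀).det ^ 2 ≠ 0 := pow_ne_zero 2 hp
  apply this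
  linarith

/-- For `r = d`, the functional is `det (α X)²` with `X` the increments of `W`; the last coarse
increment of `W` changes the right-hand side of the identity but not the left-hand side. -/
lemma not_ae_ae_pathFunctional_eq_of_rank_eq (hd : 1 ≤ d) (hW : IsBrownianMotion 𝓕 P W)
    (hW' : IsBrownianMotion 𝓕 P W') (hα : u.α.rank = d)
    (Φ : Fin d → Fin q → Fin q → (Fin q × ℝ≥0 → ℝ) → ℝ) :
    ¬ ∀ᵐ p ∂P.map (path W), ∀ᵐ p' ∂P.map (path W'),
      pathFunctional u d Φ (scalePath 1 p) (scalePath 1 p') =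
        pathFunctional u d Φ (scalePath 2 p) (scalePath 2 p') := by
  intro hpp
  obtain ⟨X₀, Y₀, hdet⟩ := exists_det_mixCols_ne_zero le_rfl hα
  have hmpW' := hW'.measurable_path
  set l : Fin d := ⟨d - 1, by omega⟩ with hl
  have hlast : ∀ j : Fin d, (j : ℕ) + 1 < d → j ≠ l := fun j hj hjl => by
    rw [hjl, hl] at hj
    simp only at hj
    omega
  have hall : (fun x : Fin q → Fin (2 * d) → ℝ =>
      (u.α * Matrix.of (firstHalf x)).det ^ 2) =
      fun x => (u.α * Matrix.of (coarse x)).det ^ 2 := by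
    refine hW.eq_of_ae_increments (n := 2 * d)
      ((continuous_const.matrix_mul continuous_firstHalf).matrix_det.pow 2)
      ((continuous_const.matrix_mul continuous_coarse).matrix_det.pow 2) ?_
    have := Measure.isProbabilityMeasure_map (μ := P) hmpW'.aemeasurable
    filter_upwards [hpp] with p hp
    obtain ⟨p', hp'⟩ := hp.exists
    simp only [pathFunctional, gammaCoef_self, increments_scalePath_one,
      increments_scalePath_two] at hp'
    exact hp'
  let X : ℝ → Matrix (Fin q) (Fin d) ℝ := fun c => X₀.updateCol l (c • X₀.col l)
  have hX : ∀ c, (u.α * X c).det = c * (mixCols d (u.α * X₀) Y₀).det := fun c => by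
    have h1 : mixCols d (u.α * X₀) Y₀ = u.α * X₀ := by
      ext i j
      simp [mixCols]
    have h2 : u.α * X c = (u.α * X₀).updateCol l (c • (u.α * X₀).col l) := by
      ext i j
      simp only [X, Matrix.mul_apply, Matrix.updateCol_apply]
      split_ifs with hj
      · simp only [Pi.smul_apply, Matrix.col_apply, Matrix.mul_apply, smul_eq_mul, Finset.mul_sum]
        refine Finset.sum_congr rfl fun m _ => ?_
        ring
      · rfl
    rw [h2, Matrix.det_updateCol_smul, h1]
    congr 2
    exact Matrix.updateCol_eq_self _ _
  have hval : ∀ c, (u.α * Matrix.of (firstHalf (spread (X c)))).det ^ 2 =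
      (c * (mixCols d (u.α * X₀) Y₀).det) ^ 2 := fun c => by
    have h1 := congrFun hall (spread (X c))
    simp only [of_coarse_spread] at h1
    rw [h1, ← hX c]
  have hsame : firstHalf (spread (X 1)) = firstHalf (spread (X 2)) := by
    refine firstHalf_spread_congr fun m j hj => ?_
    simp only [X, Matrix.updateCol_apply, if_neg (hlast j hj)]
  have h12 := hval 1
  rw [hsame, hval 2] at h12
  have : (mixCols d (u.α * X₀) Y₀).det ^ 2 ≠ 0 := pow_ne_zero 2 hdet
  apply this
  linarith

/-- The last increment of the coarse time scale moves `F_r(u, 2)` but not `F_r(u, 1)`. -/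
lemma not_FVar_one_ae_eq_FVar_two (hd : 1 ≤ d) (hW : IsBrownianMotion 𝓕 P W)
    (hW' : IsBrownianMotion 𝓕 P W') (hWW' : IndepFun (path W) (path W') P)
    (hβ : IsUnit u.β) {r : ℕ} (hr : r ≤ d) (hα : u.α.rank = r) :
    ¬ FVar 𝓕 P W W' u r 1 =ᵐ[P] FVar 𝓕 P W W' u r 2 := by
  intro heq
  obtain ⟨Φ, hΦ, hF⟩ := exists_FVar_eq_pathFunctional (W' := W') hW u r
  let G : ℕ → (Fin q × ℝ≥0 → ℝ) × (Fin d × ℝ≥0 → ℝ) → ℝ := fun κ x =>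
    pathFunctional u r Φ (scalePath κ x.1) (scalePath κ x.2)
  have hG : ∀ κ, Measurable (G κ) := fun κ =>
    measurable_pathFunctional r hΦ ((measurable_scalePath κ).comp measurable_fst)
      ((measurable_scalePath κ).comp measurable_snd)
  have hF1 : FVar 𝓕 P W W' u r 1 =ᵐ[P] fun ω => G 1 (path W ω, path W' ω) := hF 1 one_ne_zero
  have hF2 : FVar 𝓕 P W W' u r 2 =ᵐ[P] fun ω => G 2 (path W ω, path W' ω) := hF 2 two_ne_zero
  have hpp := ae_ae_eq_of_indepFun hW.measurable_path hW'.measurable_path hWW' (hG 1) (hG 2)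
    (hF1.symm.trans (heq.trans hF2))
  rcases hr.lt_or_eq with hrd | rfl
  · exact not_ae_ae_pathFunctional_eq_of_rank_lt hW hW' hβ hα hrd Φ hpp
  · exact not_ae_ae_pathFunctional_eq_of_rank_eq hd hW hW' hα Φ hpp

omit [IsProbabilityMeasure P] in
lemma FVar_eq_zero_of_rank_lt {r : ℕ} (hα : u.α.rank < r) (κ : ℕ) (ω : Ω) :
    FVar 𝓕 P W W' u r κ ω = 0 := by
  rw [FVar_eq_gammaCoef, gammaCoef_mul_eq_zero_of_rank_lt hα, zero_pow two_ne_zero]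

end

end RankTest

theorem mainTheorem5 {Ω : Type*} [mΩ : MeasurableSpace Ω] (P : Measure Ω) [IsProbabilityMeasure P]
    (𝓕 : Filtration ℝ≥0 mΩ) {d q : ℕ} (hd : 1 ≤ d)
    (W : Fin q → ℝ≥0 → Ω → ℝ) (W' : Fin d → ℝ≥0 → Ω → ℝ)
    (hW : RankTest.IsBrownianMotion 𝓕 P W) (hW' : RankTest.IsBrownianMotion 𝓕 P W')
    (hWW' : IndepFun (fun ω (p : Fin q × ℝ≥0) => W p.1 p.2 ω)
      (fun ω (p : Fin d × ℝ≥0) => W' p.1 p.2 ω) P)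
    (u : RankTest.Param d q) (hβ : IsUnit u.β) (r : ℕ) (hr : r ≤ d) :
    -- the moments exist and those of order one and two do not depend on `κ`
    (MemLp (RankTest.FVar 𝓕 P W W' u r 1) 2 P ∧ MemLp (RankTest.FVar 𝓕 P W W' u r 2) 2 P ∧
      ∫ ω, RankTest.FVar 𝓕 P W W' u r 1 ω ∂P = ∫ ω, RankTest.FVar 𝓕 P W W' u r 2 ω ∂P ∧
      ∫ ω, RankTest.FVar 𝓕 P W W' u r 1 ω ^ 2 ∂P = ∫ ω, RankTest.FVar 𝓕 P W W' u r 2 ω ^ 2 ∂P) ∧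
    (u.α.rank = r →
      0 < RankTest.Gam 𝓕 P W W' u r ∧
      RankTest.Gam'' 𝓕 P W W' u r < RankTest.Gam' 𝓕 P W W' u r) ∧
    (u.α.rank < r →
      RankTest.Gam 𝓕 P W W' u r = 0 ∧
      RankTest.Gam' 𝓕 P W W' u r = 0 ∧
      RankTest.Gam'' 𝓕 P W W' u r = 0) := by
  have hL1 := RankTest.memLp_FVar hW hW' u r one_ne_zero
  have hL2 := RankTest.memLp_FVar hW hW' u r two_ne_zero
  have hm1 := RankTest.integral_FVar_pow_eq hW hW' hWW' u r 1 one_ne_zero two_ne_zero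
  have hm2 := RankTest.integral_FVar_pow_eq hW hW' hWW' u r 2 one_ne_zero two_ne_zero
  simp only [pow_one] at hm1
  refine ⟨⟨hL1, hL2, hm1, hm2⟩, fun hα => ?_, fun hα => ?_⟩
  · have hne := RankTest.not_FVar_one_ae_eq_FVar_two hd hW hW' hWW' hβ hr hα
    have hnn : ∀ κ, 0 ≤ᵐ[P] RankTest.FVar 𝓕 P W W' u r κ := fun κ =>
      ae_of_all _ fun ω => sq_nonneg _
    constructor
    · refine lt_of_le_of_ne (integral_nonneg_of_ae (hnn 1)) fun h0 => hne ?_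
      have h1 := (integral_eq_zero_iff_of_nonneg_ae (hnn 1) (hL1.integrable one_le_two)).1 h0.symm
      have h2 := (integral_eq_zero_iff_of_nonneg_ae (hnn 2) (hL2.integrable one_le_two)).1
        (hm1.symm.trans h0.symm)
      exact h1.trans h2.symm
    · refine sub_lt_sub_right ?_ _
      have i11 := hL1.integrable_sq
      have i22 := hL2.integrable_sq
      have i12 : Integrable (fun ω => RankTest.FVar 𝓕 P W W' u r 1 ω *
          RankTest.FVar 𝓕 P W W' u r 2 ω) P := hL1.integrable_mul hL2
      -- `E F₁² - E F₁ F₂` is half the second moment of `F₁ - F₂`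
      have hpos : 0 < ∫ ω, (RankTest.FVar 𝓕 P W W' u r 1 ω -
          RankTest.FVar 𝓕 P W W' u r 2 ω) ^ 2 ∂P := by
        refine lt_of_le_of_ne (integral_nonneg fun ω => sq_nonneg _) fun h0 => hne ?_
        have := (integral_eq_zero_iff_of_nonneg_ae (ae_of_all _ fun ω => sq_nonneg _)
          (hL1.sub hL2).integrable_sq).1 h0.symm
        filter_upwards [this] with ω hω
        exact sub_eq_zero.1 (pow_eq_zero_iff two_ne_zero |>.1 hω)
      have hexp : ∫ ω, (RankTest.FVar 𝓕 P W W' u r 1 ω -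
          RankTest.FVar 𝓕 P W W' u r 2 ω) ^ 2 ∂P =
          ∫ ω, RankTest.FVar 𝓕 P W W' u r 1 ω ^ 2 ∂P + ∫ ω, RankTest.FVar 𝓕 P W W' u r 2 ω ^ 2 ∂P
          - 2 * ∫ ω, RankTest.FVar 𝓕 P W W' u r 1 ω * RankTest.FVar 𝓕 P W W' u r 2 ω ∂P := by
        rw [← integral_const_mul, ← integral_add i11 i22,
          ← integral_sub (by exact i11.add i22) (i12.const_mul 2)]
        refine integral_congr_ae (ae_of_all _ fun ω => ?_)
        simp only
        ring
      linarith
  · simp [RankTest.Gam, RankTest.Gam', RankTest.Gam'', RankTest.FVar_eq_zero_of_rank_lt hα]
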